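/- Let \(\mathbb{C}_0=\{s\in\mathbb{C}:\operatorname{Re}s>0\}\), and let \(\mathcal{A}^+\) be the Banach space of absolutely convergent Dirichlet series \(f(s)=\sum_{n\ge1}a_n n^{-s}\) with norm \(\|f\|=\sum_{n\ge1}|a_n|<\infty\). For \(\phi:\mathbb{C}_0\to\mathbb{C}\), the composition operator \(C_\phi\) is \(C_\phi f=f\circ\phi\), that is, \((C_\phi f)(s)=\sum_{n\ge1}a_n n^{-\phi(s)}\) for \(s\in\mathbb{C}_0\). It is called bounded (respectively compact) if this series converges absolutely for every \(f\in\mathcal{A}^+\) and \(s\in\mathbb{C}_0\), if \(C_\phi f\in\mathcal{A}^+\) for every \(f\in\mathcal{A}^+\), and if \(C_\phi:\mathcal{A}^+\to\mathcal{A}^+\) is a bounded (respectively compact) linear operator. Let \(r\ge2\) and \(c_0\ge0\) be integers, let \(c_1\in\mathbb{C}\), let \(c_r,c_{r^2}>0\) be real numbers, and let \[\phi(s)=c_0s+c_1+c_r\,r^{-s}+c_{r^2}\,r^{-2s}.\] (a) If \(\operatorname{Re}c_1>\dfrac{c_r^2}{8c_{r^2}}+c_{r^2}\), then \(C_\phi\)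 is bounded and even compact. (b) Suppose \(c_r\le4c_{r^2}\). If \(C_\phi\) is bounded, then \(\operatorname{Re}c_1\ge\dfrac{c_r^2}{8c_{r^2}}+c_{r^2}\). If \(C_\phi\) is compact, then \(\operatorname{Re}c_1>\dfrac{c_r^2}{8c_{r^2}}+c_{r^2}\). (c) If \(\operatorname{Re}c_1=\dfrac{c_r^2}{8c_{r^2}}+c_{r^2}\), then \(C_\phi\) is bounded if and only if \(c_r\ne4c_{r^2}\). -/

import Mathlib

open scoped ENNReal

noncomputable section

/-- The Wiener-Dirichlet algebra of absolutely convergent Dirichlet series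
`f(s) = ∑_{n ≥ 1} a_n n ^ (-s)`, with norm `∑_{n ≥ 1} |a_n|`. A series is recorded by its
coefficients `a = (a_n)`, which determine it and are determined by it as a function on the
half-plane `re s > 0`. -/
abbrev WienerDirichlet : Type := lp (fun _ : ℕ+ => ℂ) 1

namespace WienerDirichlet

/-- The `n`-th term `a_n n ^ (-s)` of the Dirichlet series `f` at the point `s`. -/
def term (f : WienerDirichlet) (s : ℂ) (n : ℕ+) : ℂ := f n * ((n : ℕ) : ℂ) ^ (-s)

/-- The value `f(s) = ∑_{n ≥ 1} a_n n ^ (-s)`; the series converges absolutely for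
`re s ≥ 0`. -/
def eval (f : WienerDirichlet) (s : ℂ) : ℂ := ∑' n : ℕ+, f.term s n

end WienerDirichlet

/-- `T` is the composition operator `f ↦ f ∘ φ` on the Wiener-Dirichlet algebra: for every `f`
in the algebra and every `s` in the half-plane `re s > 0`, the Dirichlet series of `f` converges
(absolutely) at `φ s`, and its sum `f (φ s)` equals `(T f)(s)`. Convergence for all `f` forces
`re (φ s) ≥ 0`, hence `re (φ s) > 0` throughout the half-plane when `φ` is analytic and
non-constant. -/
def IsCompositionOperator (φ : ℂ → ℂ) (T : WienerDirichlet →L[ℂ] WienerDirichlet) : Prop :=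
  ∀ (f : WienerDirichlet) (s : ℂ), 0 < s.re → HasSum (f.term (φ s)) ((T f).eval s)

/-- The composition operator with symbol `φ` is a well-defined bounded operator of the
Wiener-Dirichlet algebra into itself. -/
def BoundedComposition (φ : ℂ → ℂ) : Prop :=
  ∃ T : WienerDirichlet →L[ℂ] WienerDirichlet, IsCompositionOperator φ T

/-- The composition operator with symbol `φ` is a well-defined compact operator of the
Wiener-Dirichlet algebra into itself. -/
def CompactComposition (φ : ℂ → ℂ) : Prop :=
  ∃ T : WienerDirichlet →L[ℂ] WienerDirichlet, IsCompositionOperator φ T ∧ IsCompactOperator T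

/-- The symbol `φ(s) = c₀ s + c₁ + a r ^ (-s) + b r ^ (-2 s)`. -/
def quadraticSymbol (r c₀ : ℕ) (c₁ : ℂ) (a b : ℝ) (s : ℂ) : ℂ :=
  c₀ * s + c₁ + a * (r : ℂ) ^ (-s) + b * (r : ℂ) ^ (-(2 * s))

end

open Filter Topology MeasureTheory

/-! ### Point evaluations, monomials, and operators given by their columns -/

namespace WienerDirichlet

/-! Write `L = log n` and `E_L(z) = exp (-L (a z + b z²))`. Then `n ^ (-φ s)` is a constant of
modulus `n ^ (-re c₁)` times `(n ^ c₀) ^ (-s) * E_L (r ^ (-s))`. On an ℓ¹ space an operator is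
controlled by its columns, so everything reduces to the ℓ¹ norm of the Taylor coefficients of `E_L`.
With `M = a²/(8b) + b` and `q = -a/(4b)`, `|E_L(e^{iθ})| = exp (L (M - 2b (cos θ - q)²))`.

Upper bounds: Cauchy–Schwarz with weights `L + (k - 2bL)²`, and Bessel for `E_L` and `(z d/dz - 2bL)
E_L`, bound the ℓ¹ norm by `e^{LM} √(C √L J)`, where `J = ∫ exp (-2bL (cos θ - q)²)`. Always `J ≤
2π`, so above the threshold the column norms tend to 0 and the operator is compact. If `q ≠ -1`, the
zeros of `cos θ - q`, if any, are simple, `J = O(L^{-1/2})`, and the operator is bounded at the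
threshold too.

Necessity: if `a ≤ 4b`, some boundary point has `cos θ = q`, and evaluation there has size `n ^ (M -
re c₁)`. At the threshold this modulus is 1 for every `n`, which excludes compactness.

Critical case `a = 4b`, `re c₁ = M`: at `θ = π` the modulus is flat to fourth order while the phase
has a cubic term. Sampled off centre at a suitable scale, the phase becomes `π j²/N` plus a linear
term. Put `j = u + v`: functionals with the conjugate phases reach `N²` on a column but are at most
`N^{3/2}` on monomials (`norm_bilinear_fourierMatrix_le`). Hence `N² ≤ ‖T‖ N^{3/2}` for all `N`. -/

theorem summable_norm (f : WienerDirichlet) : Summable fun n => ‖f n‖ := by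
  simpa using (lp.memℓp f).summable (by norm_num)

theorem norm_eq_tsum (f : WienerDirichlet) : ‖f‖ = ∑' n, ‖f n‖ := by
  simpa using lp.norm_eq_tsum_rpow (by norm_num) f

theorem norm_natCast_cpow_neg (n : ℕ+) (s : ℂ) :
    ‖((n : ℕ) : ℂ) ^ (-s)‖ = Real.exp (-(Real.log n * s.re)) := by
  rw [Complex.norm_natCast_cpow_of_pos n.pos, Real.rpow_def_of_pos (by exact_mod_cast n.pos)]
  simp

theorem norm_natCast_cpow_neg_le_one (n : ℕ+) {s : ℂ} (hs : 0 ≤ s.re) :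
    ‖((n : ℕ) : ℂ) ^ (-s)‖ ≤ 1 := by
  rw [norm_natCast_cpow_neg, Real.exp_le_one_iff, neg_nonpos]
  exact mul_nonneg (Real.log_nonneg (Nat.one_le_cast.2 n.pos)) hs

theorem norm_term_le (f : WienerDirichlet) {s : ℂ} (hs : 0 ≤ s.re) (n : ℕ+) :
    ‖f.term s n‖ ≤ ‖f n‖ := by
  rw [term, norm_mul]
  exact mul_le_of_le_one_right (norm_nonneg _) (norm_natCast_cpow_neg_le_one n hs)

theorem summable_term (f : WienerDirichlet) {s : ℂ} (hs : 0 ≤ s.re) : Summable (f.term s) :=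
  .of_norm_bounded f.summable_norm (f.norm_term_le hs)

/-- Evaluation at a point of the closed right half-plane, as a continuous linear functional. -/
noncomputable def evalCLM (s : ℂ) (hs : 0 ≤ s.re) : WienerDirichlet →L[ℂ] ℂ :=
  LinearMap.mkContinuous
    { toFun := fun f => f.eval s
      map_add' := fun f g => by
        rw [eval, eval, eval, ← (f.summable_term hs).tsum_add (g.summable_term hs)]
        simp [term, add_mul]
      map_smul' := fun c f => by
        rw [eval, eval, RingHom.id_apply, smul_eq_mul, ← tsum_mul_left]
        simp [term, mul_assoc] } 1
    fun f => by
      rw [one_mul, norm_eq_tsum]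
      exact tsum_of_norm_bounded f.summable_norm.hasSum (f.norm_term_le hs)

@[simp] theorem evalCLM_apply (s : ℂ) (hs : 0 ≤ s.re) (f : WienerDirichlet) :
    evalCLM s hs f = f.eval s := rfl

theorem norm_eval_le (f : WienerDirichlet) {s : ℂ} (hs : 0 ≤ s.re) : ‖f.eval s‖ ≤ ‖f‖ := by
  rw [norm_eq_tsum]
  exact tsum_of_norm_bounded f.summable_norm.hasSum (f.norm_term_le hs)

/-- The monomial `n ^ (-s)`. -/
noncomputable def monomial (n : ℕ+) : WienerDirichlet := lp.single 1 n 1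

theorem norm_monomial (n : ℕ+) : ‖monomial n‖ = 1 := by
  rw [monomial, lp.norm_single one_pos, norm_one]

theorem hasSum_term_monomial (n : ℕ+) (s : ℂ) :
    HasSum ((monomial n).term s) (((n : ℕ) : ℂ) ^ (-s)) := by
  have h := hasSum_single (f := (monomial n).term s) n
    (fun m hm => by simp [term, monomial, hm])
  simpa [term, monomial] using h

theorem eval_monomial (n : ℕ+) (s : ℂ) : (monomial n).eval s = ((n : ℕ) : ℂ) ^ (-s) :=
  (hasSum_term_monomial n s).tsum_eq

/-- A linear functional that combines finitely many point evaluations is bounded by its largest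
value on the monomials. -/
theorem norm_sum_eval_le (f : WienerDirichlet) {ι : Type*} (I : Finset ι) (α : ι → ℂ) (s : ι → ℂ)
    (hs : ∀ i, 0 ≤ (s i).re) {B : ℝ}
    (hB : ∀ m : ℕ+, ‖∑ i ∈ I, α i * ((m : ℕ) : ℂ) ^ (-s i)‖ ≤ B) :
    ‖∑ i ∈ I, α i * f.eval (s i)‖ ≤ ‖f‖ * B := by
  have h : HasSum (fun m => f m * ∑ i ∈ I, α i * ((m : ℕ) : ℂ) ^ (-s i))
      (∑ i ∈ I, α i * f.eval (s i)) := by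
    refine (hasSum_sum fun i _ => ((f.summable_term (hs i)).hasSum.mul_left (α i))).congr_fun ?_
    intro m
    simp only [term, Finset.mul_sum]
    exact Finset.sum_congr rfl fun i _ => by ring
  rw [← h.tsum_eq, norm_eq_tsum, ← tsum_mul_right]
  refine tsum_of_norm_bounded (f.summable_norm.mul_right B).hasSum fun m => ?_
  rw [norm_mul]
  exact mul_le_mul_of_nonneg_left (hB m) (norm_nonneg _)

/-- The operator on the algebra that sends the `n`-th monomial to `v n`. -/
noncomputable def synthesis (v : ℕ+ → WienerDirichlet) (C : ℝ) (hC : ∀ n, ‖v n‖ ≤ C) :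
    WienerDirichlet →L[ℂ] WienerDirichlet :=
  have hb (f : WienerDirichlet) (n : ℕ+) : ‖f n • v n‖ ≤ ‖f n‖ * C := by
    rw [norm_smul]
    exact mul_le_mul_of_nonneg_left (hC n) (norm_nonneg _)
  have hs (f : WienerDirichlet) : Summable fun n => f n • v n :=
    .of_norm_bounded (f.summable_norm.mul_right C) (hb f)
  LinearMap.mkContinuous
    { toFun := fun f => ∑' n, f n • v n
      map_add' := fun f g => by
        rw [← (hs f).tsum_add (hs g)]
        simp [add_smul]
      map_smul' := fun c f => by
        rw [RingHom.id_apply, ← (hs f).tsum_const_smul]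
        simp [mul_smul] } C
    fun f => by
      rw [mul_comm, norm_eq_tsum f, ← tsum_mul_right]
      exact tsum_of_norm_bounded (f.summable_norm.mul_right C).hasSum (hb f)

theorem hasSum_synthesis (v : ℕ+ → WienerDirichlet) (C : ℝ) (hC : ∀ n, ‖v n‖ ≤ C)
    (f : WienerDirichlet) : HasSum (fun n => f n • v n) (synthesis v C hC f) := by
  have hs : Summable fun n => f n • v n := by
    refine .of_norm_bounded (f.summable_norm.mul_right C) fun n => ?_
    rw [norm_smul]
    exact mul_le_mul_of_nonneg_left (hC n) (norm_nonneg _)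
  exact hs.hasSum

theorem isCompositionOperator_synthesis {φ : ℂ → ℂ} (v : ℕ+ → WienerDirichlet) (C : ℝ)
    (hC : ∀ n, ‖v n‖ ≤ C)
    (hv : ∀ n s, 0 < s.re → (v n).eval s = ((n : ℕ) : ℂ) ^ (-φ s)) :
    IsCompositionOperator φ (synthesis v C hC) := by
  intro f s hs
  have h := (hasSum_synthesis v C hC f).mapL (evalCLM s hs.le)
  refine h.congr_fun fun n => ?_
  simp [term, hv n s hs]

/-- Truncations to finitely many columns have finite rank, and the truncation error is at most the
supremum of the omitted column norms. -/
theorem isCompactOperator_synthesis (v : ℕ+ → WienerDirichlet) (C : ℝ) (hC : ∀ n, ‖v n‖ ≤ C)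
    (hv : Tendsto (fun n => ‖v n‖) cofinite (𝓝 0)) :
    IsCompactOperator (synthesis v C hC) := by
  classical
  let F : Finset ℕ+ → WienerDirichlet →L[ℂ] WienerDirichlet := fun S =>
    ∑ n ∈ S, (lp.evalCLM ℂ (fun _ : ℕ+ => ℂ) 1 n).smulRight (v n)
  have hF (S : Finset ℕ+) (f : WienerDirichlet) : F S f = ∑ n ∈ S, f n • v n := by
    simp [F]
    rfl
  refine isCompactOperator_of_tendsto (l := (atTop : Filter (Finset ℕ+))) (F := F) ?_
    (Eventually.of_forall fun S => ?_)
  · rw [Metric.tendsto_nhds]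
    intro ε hε
    have hfin : {n | ¬ ‖v n‖ < ε / 2}.Finite := by
      have := hv.eventually (gt_mem_nhds (half_pos hε))
      simpa [eventually_cofinite] using this
    filter_upwards [eventually_ge_atTop hfin.toFinset] with S hS
    refine lt_of_le_of_lt ?_ (half_lt_self hε)
    rw [dist_comm, dist_eq_norm]
    refine ContinuousLinearMap.opNorm_le_bound _ (half_pos hε).le fun f => ?_
    rw [sub_apply, hF, mul_comm, norm_eq_tsum f, ← tsum_mul_right]
    -- Padding the finite sum with zeros lets the difference be bounded term by term.
    have h1 := (hasSum_synthesis v C hC f).sub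
      (hasSum_sum_of_ne_finset_zero (s := S) (f := fun n => if n ∈ S then f n • v n else 0)
        (fun n hn => by simp [hn]))
    rw [Finset.sum_congr rfl (g := fun n => f n • v n) (fun n hn => by simp [hn])] at h1
    rw [← h1.tsum_eq]
    refine tsum_of_norm_bounded (f.summable_norm.mul_right _).hasSum fun n => ?_
    by_cases hn : n ∈ S
    · simp only [hn, if_true, sub_self, norm_zero]
      positivity
    · simp only [hn, if_false, sub_zero, norm_smul]
      refine mul_le_mul_of_nonneg_left ?_ (norm_nonneg _)
      by_contra hlt
      exact hn (hS (by simpa using (not_le.1 hlt).le))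
  · refine Submodule.sum_mem (compactOperator (RingHom.id ℂ) WienerDirichlet WienerDirichlet)
      fun n _ => ?_
    exact ((isCompactOperator_id_iff_finiteDimensional (𝕜 := ℂ) (E := ℂ)).2 inferInstance).clm_comp
      (ContinuousLinearMap.toSpanSingleton ℂ (v n)) |>.comp_clm
      (lp.evalCLM ℂ (fun _ : ℕ+ => ℂ) 1 n)

/-! ### Bessel's inequality on the unit circle -/

section Bessel

open scoped Real

theorem integral_exp_int_mul_I (m : ℤ) :
    ∫ θ in (-π)..π, Complex.exp (m * Complex.I * (θ : ℂ)) = if m = 0 then (2 * π : ℂ) else 0 := by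
  split_ifs with h
  · simp [h, two_mul]
  · have hm : (m : ℂ) * Complex.I ≠ 0 := by simp [h]
    rw [integral_exp_mul_complex hm, div_eq_zero_iff, sub_eq_zero]
    left
    rw [Complex.exp_eq_exp_iff_exists_int]
    refine ⟨m, ?_⟩
    push_cast
    ring

/-- Absolute convergence permits termwise integration, and orthogonality keeps a single term. -/
theorem fourierCoeffOn_powerSeries {d : ℕ → ℂ} {g : ℝ → ℂ} (hab : -π < π)
    (hd : Summable fun k => ‖d k‖)
    (hg : ∀ θ : ℝ, HasSum (fun k => d k * Complex.exp (θ * Complex.I) ^ k) (g θ)) (k : ℕ) :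
    fourierCoeffOn hab g k = d k := by
  have hfour (θ : ℝ) : fourier (T := π - -π) (-(k : ℤ)) (θ : AddCircle (π - -π))
      = Complex.exp (-(k * (θ * Complex.I))) := by
    rw [fourier_coe_apply]
    congr 1
    have : (π : ℂ) ≠ 0 := by exact_mod_cast Real.pi_ne_zero
    push_cast
    field_simp
    ring
  have hint : HasSum (fun j : ℕ => ∫ θ in (-π)..π,
        Complex.exp (-(k * (θ * Complex.I))) * (d j * Complex.exp (θ * Complex.I) ^ j))
      (∫ θ in (-π)..π, Complex.exp (-(k * (θ * Complex.I))) * g θ) := by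
    refine intervalIntegral.hasSum_integral_of_dominated_convergence (fun j _ => ‖d j‖)
      (fun j => Continuous.aestronglyMeasurable (by fun_prop)) (fun j => ae_of_all _ fun θ _ => ?_)
      (ae_of_all _ fun θ _ => hd) (by simp) (ae_of_all _ fun θ _ => (hg θ).mul_left _)
    have h1 : ‖Complex.exp (-(k * (θ * Complex.I)))‖ = 1 := by simp [Complex.norm_exp]
    simp [h1, Complex.norm_exp_ofReal_mul_I]
  have hterm (j : ℕ) : ∫ θ in (-π)..π,
        Complex.exp (-(k * (θ * Complex.I))) * (d j * Complex.exp (θ * Complex.I) ^ j)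
      = if j = k then 2 * π * d k else 0 := by
    have : ∀ θ : ℝ, Complex.exp (-(k * (θ * Complex.I))) * (d j * Complex.exp (θ * Complex.I) ^ j)
        = d j * Complex.exp (((j : ℤ) - (k : ℤ) : ℤ) * Complex.I * (θ : ℂ)) := fun θ => by
      rw [← Complex.exp_nat_mul, mul_left_comm, ← Complex.exp_add]
      congr 2
      push_cast
      ring
    simp_rw [this]
    rw [intervalIntegral.integral_const_mul, integral_exp_int_mul_I]
    by_cases hjk : j = k
    · subst hjk
      simp [mul_comm]
    · rw [if_neg (by omega), if_neg hjk, mul_zero]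
  simp_rw [hterm] at hint
  have hval := hint.unique (hasSum_ite_eq k (2 * π * d k))
  rw [fourierCoeffOn_eq_integral]
  simp_rw [hfour, smul_eq_mul]
  rw [hval, Complex.real_smul]
  have : (π : ℂ) ≠ 0 := by exact_mod_cast Real.pi_ne_zero
  push_cast
  field_simp
  ring

/-- Bessel's inequality for the boundary values of an absolutely convergent power series. -/
theorem sum_norm_sq_le_integral {d : ℕ → ℂ} {G : ℂ → ℂ} (hd : Summable fun k => ‖d k‖)
    (hG : ∀ z : ℂ, ‖z‖ = 1 → HasSum (fun k => d k * z ^ k) (G z)) (N : ℕ) :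
    ∑ k ∈ Finset.range N, ‖d k‖ ^ 2 ≤
      (2 * π)⁻¹ * ∫ θ in (-π)..π, ‖G (Complex.exp (θ * Complex.I))‖ ^ 2 := by
  have hab : -π < π := by linarith [Real.pi_pos]
  set g : ℝ → ℂ := fun θ => G (Complex.exp (θ * Complex.I)) with hg
  have hnorm (θ : ℝ) : ‖Complex.exp (θ * Complex.I)‖ = 1 := Complex.norm_exp_ofReal_mul_I θ
  have hsum (θ : ℝ) : HasSum (fun k => d k * Complex.exp (θ * Complex.I) ^ k) (g θ) :=
    hG _ (hnorm θ)
  have hcont : Continuous g := by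
    have h : g = fun θ : ℝ => ∑' k, d k * Complex.exp (θ * Complex.I) ^ k :=
      funext fun θ => (hsum θ).tsum_eq.symm
    rw [h]
    refine continuous_tsum (fun k => by fun_prop) hd fun k θ => ?_
    simp [hnorm]
  have hL2 : MemLp g 2 (volume.restrict (Set.Ioc (-π) π)) := by
    refine .of_bound hcont.aestronglyMeasurable (∑' k, ‖d k‖) (ae_of_all _ fun θ => ?_)
    rw [← (hsum θ).tsum_eq]
    exact tsum_of_norm_bounded hd.hasSum fun k => by simp [hnorm]
  have h := hasSum_sq_fourierCoeffOn hab hL2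
  have h2 := sum_le_hasSum ((Finset.range N).map ⟨((↑) : ℕ → ℤ), Nat.cast_injective⟩)
    (fun i _ => by positivity) h
  rw [Finset.sum_map] at h2
  simp only [Function.Embedding.coeFn_mk, fourierCoeffOn_powerSeries hab hd hsum] at h2
  refine h2.trans_eq ?_
  rw [smul_eq_mul]
  congr 2
  ring

end Bessel

/-! ### Sums of Lorentzian weights -/

section Lattice

/-- The right side is the integral of `(A + |x|)⁻²` over `[y, y + 1]`, where `|x| ≤ |y| + 1`. It is
in telescoping form; the cases locate 0 relative to the interval. -/
theorem inv_sq_add_abs_le_sub {A : ℝ} (hA : 0 < A) (y : ℝ) :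
    ((A + 1 + |y|) ^ 2)⁻¹ ≤ (y + 1) / (A * (A + |y + 1|)) - y / (A * (A + |y|)) := by
  rcases le_total 0 y with hy | hy
  · rw [abs_of_nonneg hy, abs_of_nonneg (by linarith)]
    have h : (y + 1) / (A * (A + (y + 1))) - y / (A * (A + y)) = ((A + y) * (A + 1 + y))⁻¹ := by
      have : A + y ≠ 0 := by positivity
      have : A + 1 + y ≠ 0 := by positivity
      have : A + (y + 1) ≠ 0 := by positivity
      field_simp
      ring
    rw [h]
    gcongr
    nlinarith
  · rcases le_total 0 (y + 1) with hy1 | hy1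
    · rw [abs_of_nonpos hy, abs_of_nonneg hy1]
      have h1 : (y + 1) / (A * (A + 1)) ≤ (y + 1) / (A * (A + (y + 1))) := by
        gcongr
        linarith
      have h2 : -y / (A * (A + 1)) ≤ -y / (A * (A + -y)) := by
        have : 0 < A + -y := by linarith
        gcongr
        · linarith
        · linarith
      have h3 : ((A + 1 + -y) ^ 2)⁻¹ ≤ (A * (A + 1))⁻¹ := by
        gcongr
        nlinarith
      have h4 : (A * (A + 1))⁻¹ = (y + 1) / (A * (A + 1)) + -y / (A * (A + 1)) := by
        field_simp
        ring
      have h5 : -y / (A * (A + -y)) = -(y / (A * (A + -y))) := neg_div _ _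
      linarith
    · rw [abs_of_nonpos hy, abs_of_nonpos hy1]
      have p1 : 0 < A + -y := by linarith
      have p2 : 0 < A + -(y + 1) := by linarith
      have h : (y + 1) / (A * (A + -(y + 1))) - y / (A * (A + -y))
          = ((A + -y) * (A + -(y + 1)))⁻¹ := by
        field_simp
        ring
      rw [h]
      gcongr
      nlinarith

/-- A sum of Lorentzian weights is controlled by the inverse width, uniformly in the centre. -/
theorem sum_inv_sq_add_sq_le {A δ : ℝ} (hδ : 0 < δ) (hA : δ ≤ A) (x : ℝ) (N : ℕ) :
    ∑ k ∈ Finset.range N, (A ^ 2 + (k - x) ^ 2)⁻¹ ≤ 4 * (1 + δ⁻¹) ^ 2 / A := by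
  have hA0 : 0 < A := hδ.trans_le hA
  have hstep (k : ℕ) : (A ^ 2 + (k - x) ^ 2)⁻¹ ≤ 2 * (1 + δ⁻¹) ^ 2 *
      ((((k + 1 : ℕ) : ℝ) - x) / (A * (A + |((k + 1 : ℕ) : ℝ) - x|))
        - (k - x) / (A * (A + |k - x|))) := by
    have h1 := inv_sq_add_abs_le_sub hA0 (k - x)
    have e : ((k + 1 : ℕ) : ℝ) - x = k - x + 1 := by push_cast; ring
    rw [e]
    refine le_trans ?_ (mul_le_mul_of_nonneg_left h1 (by positivity))
    set y := (k : ℝ) - x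
    -- The lower bound `δ ≤ A` absorbs the summand 1.
    have h2 : A + 1 + |y| ≤ (1 + δ⁻¹) * (A + |y|) := by
      have : 1 ≤ δ⁻¹ * A := by rw [inv_mul_eq_div, one_le_div hδ]; exact hA
      nlinarith [abs_nonneg y, inv_pos.2 hδ, mul_nonneg (inv_pos.2 hδ).le (abs_nonneg y)]
    have h3 : (A + 1 + |y|) ^ 2 ≤ 2 * (1 + δ⁻¹) ^ 2 * (A ^ 2 + y ^ 2) := by
      calc (A + 1 + |y|) ^ 2 ≤ ((1 + δ⁻¹) * (A + |y|)) ^ 2 := by gcongr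
        _ = (1 + δ⁻¹) ^ 2 * (A + |y|) ^ 2 := by ring
        _ ≤ (1 + δ⁻¹) ^ 2 * (2 * (A ^ 2 + y ^ 2)) := by
          gcongr
          nlinarith [sq_nonneg (A - |y|), sq_abs y]
        _ = _ := by ring
    rw [← div_eq_mul_inv, inv_eq_one_div, div_le_div_iff₀ (by positivity) (by positivity)]
    linarith
  have hbound (y : ℝ) : |y / (A * (A + |y|))| ≤ A⁻¹ := by
    have hp : 0 < A + |y| := by positivity
    rw [abs_div, abs_of_pos (mul_pos hA0 hp), div_le_iff₀ (by positivity), inv_mul_cancel_left₀ hA0.ne']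
    linarith
  refine (Finset.sum_le_sum fun k _ => hstep k).trans ?_
  rw [← Finset.mul_sum, Finset.sum_range_sub (fun k : ℕ => ((k : ℝ) - x) / (A * (A + |(k : ℝ) - x|)))]
  have h1 := (abs_le.1 (hbound ((N : ℝ) - x))).2
  have h2 := (abs_le.1 (hbound (((0 : ℕ) : ℝ) - x))).1
  calc _ ≤ 2 * (1 + δ⁻¹) ^ 2 * (2 * A⁻¹) := by
        gcongr
        linarith
    _ = _ := by ring

end Lattice

/-! ### The Laplace-type integral away from `q = -1` -/

section Gauss

open scoped Real

/-- For `q < -1` the difference never vanishes and `t = 0` serves. For `q > -1` the zeros `±t` are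
simple, because `t = arccos q` lies strictly inside `(0, π)`. -/
theorem exists_abs_cos_sub_ge {q : ℝ} (hq0 : q < 0) (hq : q ≠ -1) :
    ∃ c > 0, ∃ t : ℝ, ∀ θ ∈ Set.Icc (-π) π, c * (|θ| - t) ^ 2 ≤ (Real.cos θ - q) ^ 2 := by
  rcases lt_or_gt_of_ne hq with h | h
  · refine ⟨((-1 - q) / π) ^ 2, pow_pos (div_pos (by linarith) Real.pi_pos) 2, 0, fun θ hθ => ?_⟩
    have hθ' : |θ| ≤ π := abs_le.2 hθ
    have h1 : (-1 - q) / π * |θ| ≤ -1 - q := by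
      rw [div_mul_eq_mul_div, div_le_iff₀ Real.pi_pos]
      exact mul_le_mul_of_nonneg_left hθ' (by linarith)
    have h2 : -1 - q ≤ Real.cos θ - q := by linarith [Real.neg_one_le_cos θ]
    rw [sub_zero, ← mul_pow]
    have : 0 ≤ (-1 - q) / π * |θ| :=
      mul_nonneg (div_nonneg (by linarith) Real.pi_pos.le) (abs_nonneg _)
    exact pow_le_pow_left₀ this (h1.trans h2) 2
  · set t := Real.arccos q with ht
    have hcos : Real.cos t = q := Real.cos_arccos h.le (by linarith)
    have ht0 : π / 2 < t := not_le.1 fun h' => by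
      linarith [Real.arccos_le_pi_div_two.1 h']
    have htπ : t < π := by
      refine lt_of_le_of_ne (Real.arccos_le_pi q) fun h' => ?_
      rw [h', Real.cos_pi] at hcos
      linarith
    have hs : 0 < Real.cos (t / 2) := Real.cos_pos_of_mem_Ioo ⟨by linarith, by linarith⟩
    refine ⟨(Real.cos (t / 2) * (2 / π)) ^ 2, by positivity, t, fun θ hθ => ?_⟩
    have hθ' : |θ| ≤ π := abs_le.2 hθ
    have hθ0 := abs_nonneg θ
    rw [← Real.cos_abs θ, ← hcos, Real.cos_sub_cos, ← mul_pow, ← sq_abs, ← sq_abs (-2 * _ * _)]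
    refine pow_le_pow_left₀ (abs_nonneg _) ?_ 2
    have hc : 0 < Real.cos (t / 2) * (2 / π) := by positivity
    rw [abs_mul, abs_of_pos hc, abs_mul, abs_mul, abs_neg, abs_two]
    -- The half-sum stays within `t / 2` of `π / 2` because `t > π / 2`, which is where `q < 0`
    -- enters.
    have h1 : Real.cos (t / 2) ≤ |Real.sin ((|θ| + t) / 2)| := by
      refine le_trans ?_ (le_abs_self _)
      rw [← Real.cos_sub_pi_div_two]
      rw [← Real.cos_abs ((|θ| + t) / 2 - π / 2)]
      refine Real.cos_le_cos_of_nonneg_of_le_pi (abs_nonneg _) (by linarith) ?_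
      rw [abs_le]
      constructor <;> linarith
    have h2 : 2 / π * |(|θ| - t) / 2| ≤ |Real.sin ((|θ| - t) / 2)| := by
      refine Real.mul_abs_le_abs_sin ?_
      rw [abs_le]
      constructor <;> linarith
    calc Real.cos (t / 2) * (2 / π) * |(|θ| - t)|
        = 2 * Real.cos (t / 2) * (2 / π * |(|θ| - t) / 2|) := by
          rw [abs_div, abs_two]; ring
      _ ≤ _ := by gcongr

/-- The integrand lies below two Gaussians centred at `±t`, each of mass of order `K^{-1/2}`. -/
theorem exists_integral_exp_neg_le {q : ℝ} (hq0 : q < 0) (hq : q ≠ -1) :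
    ∃ C, ∀ K > 0, ∫ θ in (-π)..π, Real.exp (-K * (Real.cos θ - q) ^ 2) ≤ C / √K := by
  obtain ⟨c, hc, t, h⟩ := exists_abs_cos_sub_ge hq0 hq
  refine ⟨2 * √(π / c), fun K hK => ?_⟩
  have hKc : 0 < K * c := mul_pos hK hc
  set γ : ℝ → ℝ := fun x => Real.exp (-(K * c) * x ^ 2) with hγ
  have hint : Integrable γ := integrable_exp_neg_mul_sq hKc
  have hle : -π ≤ π := by linarith [Real.pi_pos]
  have hpt : ∀ θ ∈ Set.Icc (-π) π,
      Real.exp (-K * (Real.cos θ - q) ^ 2) ≤ γ (θ - t) + γ (θ + t) := fun θ hθ => by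
    have h1 : Real.exp (-K * (Real.cos θ - q) ^ 2) ≤ γ (|θ| - t) := by
      simp only [hγ, Real.exp_le_exp]
      nlinarith [mul_le_mul_of_nonneg_left (h θ hθ) hK.le]
    rcases abs_cases θ with ⟨h2, -⟩ | ⟨h2, -⟩
    · rw [h2] at h1
      exact h1.trans (le_add_of_nonneg_right (Real.exp_pos _).le)
    · have h3 : γ (|θ| - t) = γ (θ + t) := by
        simp only [hγ, h2]
        congr 2
        ring
      rw [h3] at h1
      exact h1.trans (le_add_of_nonneg_left (Real.exp_pos _).le)
  have hi : Integrable fun θ => γ (θ - t) + γ (θ + t) :=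
    (hint.comp_sub_right t).add (hint.comp_add_right t)
  calc ∫ θ in (-π)..π, Real.exp (-K * (Real.cos θ - q) ^ 2)
      ≤ ∫ θ in (-π)..π, (γ (θ - t) + γ (θ + t)) :=
        intervalIntegral.integral_mono_on hle (Continuous.intervalIntegrable (by fun_prop) _ _)
          hi.intervalIntegrable hpt
    _ ≤ ∫ θ, (γ (θ - t) + γ (θ + t)) := by
        rw [intervalIntegral.integral_of_le hle]
        exact setIntegral_le_integral hi (ae_of_all _ fun θ => by positivity)
    _ = 2 * √(π / (K * c)) := by
        rw [integral_add (hint.comp_sub_right t) (hint.comp_add_right t),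
          integral_sub_right_eq_self γ, integral_add_right_eq_self γ, hγ, integral_gaussian]
        ring
    _ = 2 * √(π / c) / √K := by
        rw [mul_comm K, ← div_div, Real.sqrt_div' _ hK.le]
        ring

end Gauss

/-! ### Taylor coefficients of the quadratic exponential -/

section QuadraticExponential

open scoped Real

/-- The entire function `exp (-L (a z + b z ^ 2))`. -/
noncomputable def quadExp (a b L : ℝ) (z : ℂ) : ℂ := Complex.exp (-(L * (a * z + b * z ^ 2)))

/-- The Taylor coefficients at the origin of `exp (-L (a z + b z ^ 2))`. -/
noncomputable def quadExpCoeff (a b L : ℝ) (k : ℕ) : ℂ :=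
  (k.factorial : ℂ)⁻¹ * iteratedDeriv k (quadExp a b L) 0

theorem hasDerivAt_quadExp (a b L : ℝ) (z : ℂ) :
    HasDerivAt (quadExp a b L) (-(L * (a + 2 * b * z)) * quadExp a b L z) z := by
  have h1 : HasDerivAt (fun z : ℂ => (a : ℂ) * z + b * z ^ 2) (a * 1 + b * (2 * z)) z := by
    refine ((hasDerivAt_id z).const_mul (a : ℂ)).add
      (((hasDerivAt_pow 2 z).const_mul (b : ℂ)).congr_deriv ?_)
    norm_num
  refine (h1.const_mul (L : ℂ)).neg.cexp.congr_deriv ?_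
  simp only [quadExp, Pi.neg_apply]
  ring

theorem differentiable_quadExp (a b L : ℝ) : Differentiable ℂ (quadExp a b L) :=
  fun z => (hasDerivAt_quadExp a b L z).differentiableAt

theorem hasSum_quadExpCoeff (a b L : ℝ) (z : ℂ) :
    HasSum (fun k => quadExpCoeff a b L k * z ^ k) (quadExp a b L z) := by
  refine (Complex.hasSum_taylorSeries_of_entire (differentiable_quadExp a b L) 0 z).congr_fun
    fun k => ?_
  simp only [quadExpCoeff, smul_eq_mul, sub_zero]
  ring

theorem hasSum_deriv_quadExpCoeff (a b L : ℝ) (z : ℂ) :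
    HasSum (fun k : ℕ => (k : ℂ) * quadExpCoeff a b L k * z ^ k)
      (z * (-(L * (a + 2 * b * z)) * quadExp a b L z)) := by
  have hd : deriv (quadExp a b L) = fun z => -(L * (a + 2 * b * z)) * quadExp a b L z :=
    funext fun z => (hasDerivAt_quadExp a b L z).deriv
  have hdiff : Differentiable ℂ (deriv (quadExp a b L)) := by
    rw [hd]
    have := differentiable_quadExp a b L
    fun_prop
  have h := (Complex.hasSum_taylorSeries_of_entire hdiff 0 z).mul_left z
  rw [congrFun hd z] at h
  rw [← hasSum_nat_add_iff' 1]
  simp only [Finset.range_one, Finset.sum_singleton, Nat.cast_zero, zero_mul, sub_zero]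
  refine h.congr_fun fun k => ?_
  have hk : ((k : ℂ) + 1) ≠ 0 := by exact_mod_cast k.succ_ne_zero
  have hf : (k.factorial : ℂ) ≠ 0 := by exact_mod_cast k.factorial_ne_zero
  simp only [quadExpCoeff, smul_eq_mul, sub_zero, iteratedDeriv_succ', Nat.factorial_succ]
  push_cast
  field_simp
  ring

theorem summable_norm_of_hasSum_pow {d : ℕ → ℂ} {G : ℂ → ℂ}
    (h : ∀ z, HasSum (fun k => d k * z ^ k) (G z)) : Summable fun k => ‖d k‖ := by
  have := (h 1).summable
  simp only [one_pow, mul_one] at this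
  exact this.norm

theorem summable_norm_quadExpCoeff (a b L : ℝ) : Summable fun k => ‖quadExpCoeff a b L k‖ :=
  summable_norm_of_hasSum_pow (hasSum_quadExpCoeff a b L)

/-- Completing the square in `cos θ`; the constant left over is the threshold for `re c₁`. -/
theorem norm_quadExp_exp_mul_I {a b : ℝ} (hb : 0 < b) (L θ : ℝ) :
    ‖quadExp a b L (Complex.exp (θ * Complex.I))‖ =
      Real.exp (L * (a ^ 2 / (8 * b) + b - 2 * b * (Real.cos θ - -a / (4 * b)) ^ 2)) := by
  rw [quadExp, Complex.norm_exp, ← Complex.exp_nat_mul]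
  congr 1
  have h2 : ((2 : ℕ) : ℂ) * (θ * Complex.I) = ((2 * θ : ℝ) : ℂ) * Complex.I := by
    push_cast; ring
  rw [h2]
  simp only [Complex.neg_re, Complex.re_ofReal_mul, Complex.add_re, Complex.exp_ofReal_mul_I_re,
    Real.cos_two_mul]
  field_simp
  ring

/-- On the circle the expression is `z (a + 2b (z + z̄))`, so it vanishes exactly where `cos θ =
-a/(4b)`. -/
theorem norm_weight_eq (a b θ : ℝ) (hb : 0 < b) :
    ‖(a : ℂ) * Complex.exp (θ * Complex.I) + 2 * b * Complex.exp (θ * Complex.I) ^ 2 + 2 * b‖ =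
      4 * b * |Real.cos θ - -a / (4 * b)| := by
  have h : (a : ℂ) * Complex.exp (θ * Complex.I) + 2 * b * Complex.exp (θ * Complex.I) ^ 2 + 2 * b
      = Complex.exp (θ * Complex.I) * ((4 * b * (Real.cos θ - -a / (4 * b)) : ℝ) : ℂ) := by
    have h1 : Complex.exp (θ * Complex.I) * Complex.exp (-(θ * Complex.I)) = 1 := by
      rw [← Complex.exp_add]; simp
    have hb' : (b : ℂ) ≠ 0 := by exact_mod_cast hb.ne'
    push_cast
    rw [Complex.cos, neg_mul]
    field_simp
    linear_combination (-4 * b : ℂ) * h1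
  rw [h, norm_mul, Complex.norm_exp_ofReal_mul_I, one_mul, Complex.norm_real, Real.norm_eq_abs,
    abs_mul, abs_of_pos (by positivity)]

/-- The centre `2bL` makes the symbol of `z d/dz - 2bL` vanish where the modulus of the exponential
attains `exp (L (a²/(8b) + b))`, so the derivative costs only a factor of order `√L` in L². -/
theorem weighted_sum_quadExpCoeff_le {a b L : ℝ} (hb : 0 < b) (hL : 0 < L) (N : ℕ) :
    ∑ k ∈ Finset.range N, (L + (k - 2 * b * L) ^ 2) * ‖quadExpCoeff a b L k‖ ^ 2 ≤
      (2 * π)⁻¹ * ((1 + 8 * b) * L * Real.exp (2 * (L * (a ^ 2 / (8 * b) + b))) *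
        ∫ θ in (-π)..π, Real.exp (-(2 * b * L) * (Real.cos θ - -a / (4 * b)) ^ 2)) := by
  set d : ℕ → ℂ := fun k => (k - 2 * b * L) * quadExpCoeff a b L k with hd
  have hdG : ∀ z : ℂ, HasSum (fun k => d k * z ^ k)
      (-L * (a * z + 2 * b * z ^ 2 + 2 * b) * quadExp a b L z) := fun z => by
    have h := (hasSum_deriv_quadExpCoeff a b L z).sub
      ((hasSum_quadExpCoeff a b L z).mul_left (2 * b * L : ℂ))
    have e : -L * (a * z + 2 * b * z ^ 2 + 2 * b) * quadExp a b L z =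
        z * (-(L * (a + 2 * b * z)) * quadExp a b L z) - 2 * b * L * quadExp a b L z := by ring
    rw [e]
    refine h.congr_fun fun k => ?_
    simp only [hd]
    ring
  have hB1 := sum_norm_sq_le_integral (summable_norm_quadExpCoeff a b L)
    (fun z _ => hasSum_quadExpCoeff a b L z) N
  have hB2 := sum_norm_sq_le_integral (summable_norm_of_hasSum_pow hdG) (fun z _ => hdG z) N
  have hsplit : ∑ k ∈ Finset.range N, (L + (k - 2 * b * L) ^ 2) * ‖quadExpCoeff a b L k‖ ^ 2
      = L * ∑ k ∈ Finset.range N, ‖quadExpCoeff a b L k‖ ^ 2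
        + ∑ k ∈ Finset.range N, ‖d k‖ ^ 2 := by
    rw [Finset.mul_sum, ← Finset.sum_add_distrib]
    refine Finset.sum_congr rfl fun k _ => ?_
    have h1 : ‖(k - 2 * b * L : ℂ)‖ ^ 2 = (k - 2 * b * L) ^ 2 := by
      have : (k - 2 * b * L : ℂ) = ((k - 2 * b * L : ℝ) : ℂ) := by push_cast; ring
      rw [this, Complex.norm_real, Real.norm_eq_abs, sq_abs]
    rw [hd]
    dsimp only
    rw [norm_mul, mul_pow, h1]
    ring
  have hcE : Continuous (quadExp a b L) := (differentiable_quadExp a b L).continuous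
  have hle : -π ≤ π := by linarith [Real.pi_pos]
  rw [hsplit]
  calc _ ≤ L * ((2 * π)⁻¹ * ∫ θ in (-π)..π, ‖quadExp a b L (Complex.exp (θ * Complex.I))‖ ^ 2) +
        _ := add_le_add (mul_le_mul_of_nonneg_left hB1 hL.le) hB2
    _ = (2 * π)⁻¹ * ∫ θ in (-π)..π, (L * ‖quadExp a b L (Complex.exp (θ * Complex.I))‖ ^ 2 +
          ‖-L * (a * Complex.exp (θ * Complex.I) + 2 * b * Complex.exp (θ * Complex.I) ^ 2 + 2 * b)
            * quadExp a b L (Complex.exp (θ * Complex.I))‖ ^ 2) := by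
        rw [intervalIntegral.integral_add, intervalIntegral.integral_const_mul]
        · ring
        · exact Continuous.intervalIntegrable (by fun_prop) _ _
        · exact Continuous.intervalIntegrable (by fun_prop) _ _
    _ ≤ _ := by
        rw [← intervalIntegral.integral_const_mul
          ((1 + 8 * b) * L * Real.exp (2 * (L * (a ^ 2 / (8 * b) + b))))]
        refine mul_le_mul_of_nonneg_left ?_ (by positivity)
        refine intervalIntegral.integral_mono_on hle (Continuous.intervalIntegrable (by fun_prop) _ _)
          (Continuous.intervalIntegrable (by fun_prop) _ _) fun θ _ => ?_
        rw [norm_mul, norm_mul, norm_weight_eq a b θ hb, norm_quadExp_exp_mul_I hb, norm_neg,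
          Complex.norm_real, Real.norm_eq_abs, abs_of_pos hL]
        set x := Real.cos θ - -a / (4 * b)
        set M := a ^ 2 / (8 * b) + b
        have h1 : Real.exp (L * (M - 2 * b * x ^ 2)) ^ 2 = Real.exp (2 * (L * M)) *
            (Real.exp (-(2 * b * L) * x ^ 2) * Real.exp (-(2 * b * L) * x ^ 2)) := by
          rw [← Real.exp_nat_mul, ← Real.exp_add, ← Real.exp_add]
          congr 1
          push_cast
          ring
        -- Half of the Gaussian decay absorbs the polynomial factor; the other half remains in the
        -- integral.
        have h2 : (1 + 8 * b * (2 * b * L * x ^ 2)) * Real.exp (-(2 * b * L) * x ^ 2)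
            ≤ 1 + 8 * b := by
          have h3 := Real.add_one_le_exp (2 * b * L * x ^ 2)
          have h4 : Real.exp (2 * b * L * x ^ 2) * Real.exp (-(2 * b * L) * x ^ 2) = 1 := by
            rw [← Real.exp_add]; simp
          have h5 : 0 ≤ 2 * b * L * x ^ 2 := by positivity
          calc _ ≤ ((1 + 8 * b) * Real.exp (2 * b * L * x ^ 2))
                * Real.exp (-(2 * b * L) * x ^ 2) := by
                gcongr
                nlinarith
            _ = 1 + 8 * b := by rw [mul_assoc, h4, mul_one]
        rw [mul_pow, mul_pow, mul_pow, h1, sq_abs]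
        calc _ = L * Real.exp (2 * (L * M)) * Real.exp (-(2 * b * L) * x ^ 2) *
              ((1 + 8 * b * (2 * b * L * x ^ 2)) * Real.exp (-(2 * b * L) * x ^ 2)) := by ring
          _ ≤ L * Real.exp (2 * (L * M)) * Real.exp (-(2 * b * L) * x ^ 2) * (1 + 8 * b) := by
              gcongr
          _ = _ := by ring

/-- Cauchy–Schwarz with weights of width `√L`, whose reciprocals sum to `O(L^{-1/2})`. -/
theorem exists_tsum_quadExpCoeff_le {a b δ : ℝ} (hb : 0 < b) (hδ : 0 < δ) :
    ∃ C, 0 ≤ C ∧ ∀ L ≥ δ, ∑' k, ‖quadExpCoeff a b L k‖ ≤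
      √(C * √L * ∫ θ in (-π)..π, Real.exp (-(2 * b * L) * (Real.cos θ - -a / (4 * b)) ^ 2)) *
        Real.exp (L * (a ^ 2 / (8 * b) + b)) := by
  refine ⟨4 * (1 + (√δ)⁻¹) ^ 2 * ((2 * π)⁻¹ * (1 + 8 * b)), by positivity, fun L hL => ?_⟩
  have hL0 : 0 < L := hδ.trans_le hL
  set J := ∫ θ in (-π)..π, Real.exp (-(2 * b * L) * (Real.cos θ - -a / (4 * b)) ^ 2)
  refine Real.tsum_le_of_sum_range_le (fun _ => norm_nonneg _) fun N => ?_
  have hw (k : ℕ) : 0 < L + ((k : ℝ) - 2 * b * L) ^ 2 := by positivity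
  have hCS : (∑ k ∈ Finset.range N, ‖quadExpCoeff a b L k‖) ^ 2 ≤
      (∑ k ∈ Finset.range N, (L + ((k : ℝ) - 2 * b * L) ^ 2)⁻¹) *
      ∑ k ∈ Finset.range N, (L + ((k : ℝ) - 2 * b * L) ^ 2) * ‖quadExpCoeff a b L k‖ ^ 2 := by
    refine Finset.sum_sq_le_sum_mul_sum_of_sq_le_mul _ (fun k _ => (inv_pos.2 (hw k)).le)
      (fun k _ => mul_nonneg (hw k).le (sq_nonneg _)) fun k _ => ?_
    rw [inv_mul_cancel_left₀ (hw k).ne']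
  have h1 : ∑ k ∈ Finset.range N, (L + ((k : ℝ) - 2 * b * L) ^ 2)⁻¹ ≤
      4 * (1 + (√δ)⁻¹) ^ 2 / √L := by
    have := sum_inv_sq_add_sq_le (Real.sqrt_pos.2 hδ) (Real.sqrt_le_sqrt hL) (2 * b * L) N
    rwa [Real.sq_sqrt hL0.le] at this
  have h2 := weighted_sum_quadExpCoeff_le (a := a) hb hL0 N
  refine (Real.le_sqrt_of_sq_le (hCS.trans (mul_le_mul h1 h2
    (Finset.sum_nonneg fun k _ => mul_nonneg (hw k).le (sq_nonneg _)) (by positivity)))).trans_eq ?_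
  rw [← Real.sqrt_sq (Real.exp_pos (L * (a ^ 2 / (8 * b) + b))).le, ← Real.sqrt_mul' _ (sq_nonneg _)]
  congr 1
  have h3 : Real.exp (L * (a ^ 2 / (8 * b) + b)) ^ 2
      = Real.exp (2 * (L * (a ^ 2 / (8 * b) + b))) := by
    rw [← Real.exp_nat_mul]; norm_num
  have h4 : L / √L = √L := Real.div_sqrt
  rw [h3]
  calc _ = 4 * (1 + (√δ)⁻¹) ^ 2 * ((2 * π)⁻¹ * (1 + 8 * b)) * (L / √L) * J *
        Real.exp (2 * (L * (a ^ 2 / (8 * b) + b))) := by ring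
    _ = _ := by rw [h4]

/-- Bounding the integral by `2π` loses a factor `L^{1/4}`, harmless above the threshold. -/
theorem exists_tsum_quadExpCoeff_le_sqrt {a b δ : ℝ} (hb : 0 < b) (hδ : 0 < δ) :
    ∃ C, 0 ≤ C ∧ ∀ L ≥ δ, ∑' k, ‖quadExpCoeff a b L k‖ ≤
      √(C * √L) * Real.exp (L * (a ^ 2 / (8 * b) + b)) := by
  obtain ⟨C, hC, h⟩ := exists_tsum_quadExpCoeff_le (a := a) hb hδ
  refine ⟨C * (2 * π), by positivity, fun L hL => (h L hL).trans ?_⟩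
  have hL0 : 0 < L := hδ.trans_le hL
  have hle : -π ≤ π := by linarith [Real.pi_pos]
  have hJ : ∫ θ in (-π)..π, Real.exp (-(2 * b * L) * (Real.cos θ - -a / (4 * b)) ^ 2) ≤ 2 * π := by
    have := intervalIntegral.integral_mono_on (μ := volume) hle
      (f := fun θ => Real.exp (-(2 * b * L) * (Real.cos θ - -a / (4 * b)) ^ 2)) (g := fun _ => (1 : ℝ))
      (Continuous.intervalIntegrable (by fun_prop) _ _) intervalIntegrable_const fun θ _ => by
        rw [Real.exp_le_one_iff]
        have : 0 ≤ 2 * b * L * (Real.cos θ - -a / (4 * b)) ^ 2 := by positivity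
        linarith
    refine this.trans_eq ?_
    simp
    ring
  refine mul_le_mul_of_nonneg_right (Real.sqrt_le_sqrt ?_) (Real.exp_pos _).le
  calc _ ≤ C * √L * (2 * π) := mul_le_mul_of_nonneg_left hJ (by positivity)
    _ = _ := by ring

theorem exists_tsum_quadExpCoeff_le_const {a b δ : ℝ} (ha : 0 < a) (hb : 0 < b) (hδ : 0 < δ)
    (hab : a ≠ 4 * b) :
    ∃ C, ∀ L ≥ δ, ∑' k, ‖quadExpCoeff a b L k‖ ≤
      C * Real.exp (L * (a ^ 2 / (8 * b) + b)) := by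
  obtain ⟨C, hC, h⟩ := exists_tsum_quadExpCoeff_le (a := a) hb hδ
  obtain ⟨D, hD⟩ := exists_integral_exp_neg_le (q := -a / (4 * b))
    (div_neg_of_neg_of_pos (neg_lt_zero.2 ha) (by positivity)) (fun h' => hab (by
      rw [div_eq_iff (by positivity)] at h'
      linarith))
  refine ⟨√(C * (D / √(2 * b))), fun L hL => (h L hL).trans ?_⟩
  have hL0 : 0 < L := hδ.trans_le hL
  refine mul_le_mul_of_nonneg_right (Real.sqrt_le_sqrt ?_) (Real.exp_pos _).le
  have hs : 0 < √L := Real.sqrt_pos.2 hL0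
  calc _ ≤ C * √L * (D / √(2 * b * L)) :=
        mul_le_mul_of_nonneg_left (hD _ (by positivity)) (by positivity)
    _ = _ := by
        rw [Real.sqrt_mul (by positivity)]
        field_simp

end QuadraticExponential

theorem natCast_cpow_neg_eq_exp (n : ℕ+) (w : ℂ) :
    ((n : ℕ) : ℂ) ^ (-w) = Complex.exp (-(Real.log n * w)) := by
  rw [Complex.cpow_def_of_ne_zero (by exact_mod_cast n.ne_zero), ← Complex.natCast_log, mul_neg]

theorem natCast_cpow_neg_quadraticSymbol (n : ℕ+) (r c₀ : ℕ) (c₁ : ℂ) (a b : ℝ) (s : ℂ) :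
    ((n : ℕ) : ℂ) ^ (-quadraticSymbol r c₀ c₁ a b s) =
      ((n : ℕ) : ℂ) ^ (-c₁) * ((n : ℕ) : ℂ) ^ (-(c₀ * s)) *
        quadExp a b (Real.log n) ((r : ℂ) ^ (-s)) := by
  have h : (r : ℂ) ^ (-(2 * s)) = ((r : ℂ) ^ (-s)) ^ 2 := by
    rw [← Complex.cpow_nat_mul]; congr 1; push_cast; ring
  simp only [natCast_cpow_neg_eq_exp, quadraticSymbol, quadExp, h]
  rw [← Complex.exp_add, ← Complex.exp_add]
  congr 1
  ring

/-! ### Boundedness and compactness from column norms -/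

section Sufficiency

/-- The image of the `n`-th monomial under composition with the quadratic symbol. -/
noncomputable def column (r : ℕ+) (c₀ : ℕ) (c₁ : ℂ) (a b : ℝ) (n : ℕ+) : WienerDirichlet :=
  ∑' k : ℕ, (((n : ℕ) : ℂ) ^ (-c₁) * quadExpCoeff a b (Real.log n) k) • monomial (n ^ c₀ * r ^ k)

theorem norm_column_term (r : ℕ+) (c₀ : ℕ) (c₁ : ℂ) (a b : ℝ) (n : ℕ+) (k : ℕ) :
    ‖(((n : ℕ) : ℂ) ^ (-c₁) * quadExpCoeff a b (Real.log n) k) • monomial (n ^ c₀ * r ^ k)‖ =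
      Real.exp (-(Real.log n * c₁.re)) * ‖quadExpCoeff a b (Real.log n) k‖ := by
  rw [norm_smul, norm_monomial, mul_one, norm_mul, norm_natCast_cpow_neg]

theorem hasSum_column (r : ℕ+) (c₀ : ℕ) (c₁ : ℂ) (a b : ℝ) (n : ℕ+) :
    HasSum (fun k : ℕ => (((n : ℕ) : ℂ) ^ (-c₁) * quadExpCoeff a b (Real.log n) k) •
      monomial (n ^ c₀ * r ^ k)) (column r c₀ c₁ a b n) := by
  refine Summable.hasSum (.of_norm ?_)
  simp_rw [norm_column_term]
  exact (summable_norm_quadExpCoeff a b _).mul_left _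

theorem norm_column_le (r : ℕ+) (c₀ : ℕ) (c₁ : ℂ) (a b : ℝ) (n : ℕ+) :
    ‖column r c₀ c₁ a b n‖ ≤
      Real.exp (-(Real.log n * c₁.re)) * ∑' k, ‖quadExpCoeff a b (Real.log n) k‖ := by
  rw [column, ← tsum_mul_left]
  exact tsum_of_norm_bounded ((summable_norm_quadExpCoeff a b _).mul_left _).hasSum
    fun k => (norm_column_term r c₀ c₁ a b n k).le

theorem eval_column (r : ℕ+) (c₀ : ℕ) (c₁ : ℂ) (a b : ℝ) (n : ℕ+) {s : ℂ} (hs : 0 < s.re) :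
    (column r c₀ c₁ a b n).eval s = ((n : ℕ) : ℂ) ^ (-quadraticSymbol r c₀ c₁ a b s) := by
  have h := (hasSum_column r c₀ c₁ a b n).mapL (evalCLM s hs.le)
  have h2 := (hasSum_quadExpCoeff a b (Real.log n) (((r : ℕ) : ℂ) ^ (-s))).mul_left
    (((n : ℕ) : ℂ) ^ (-c₁) * ((n : ℕ) : ℂ) ^ (-(c₀ * s)))
  rw [natCast_cpow_neg_quadraticSymbol, ← evalCLM_apply s hs.le]
  refine h.unique (h2.congr_fun fun k => ?_)
  have h3 : (((n ^ c₀ * r ^ k : ℕ+) : ℕ) : ℂ) ^ (-s) =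
      ((n : ℕ) : ℂ) ^ (-(c₀ * s)) * (((r : ℕ) : ℂ) ^ (-s)) ^ k := by
    rw [natCast_cpow_neg_eq_exp, natCast_cpow_neg_eq_exp n, natCast_cpow_neg_eq_exp r,
      ← Complex.exp_nat_mul, ← Complex.exp_add, PNat.mul_coe, PNat.pow_coe, PNat.pow_coe,
      Nat.cast_mul, Nat.cast_pow, Nat.cast_pow,
      Real.log_mul (by positivity) (by positivity), Real.log_pow, Real.log_pow]
    congr 1
    push_cast
    ring
  rw [map_smul, evalCLM_apply, eval_monomial, h3, smul_eq_mul]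
  ring

theorem log_two_le_log {n : ℕ+} (hn : n ≠ 1) : Real.log 2 ≤ Real.log n := by
  have : 1 < (n : ℕ) := by
    have := n.pos
    have : (n : ℕ) ≠ 1 := fun h => hn (PNat.coe_eq_one_iff.1 h)
    omega
  exact Real.log_le_log two_pos (by exact_mod_cast this)

theorem boundedComposition_of_ne {r : ℕ} (hr : 0 < r) (c₀ : ℕ) {c₁ : ℂ} {a b : ℝ} (ha : 0 < a)
    (hb : 0 < b) (hab : a ≠ 4 * b) (hc : a ^ 2 / (8 * b) + b ≤ c₁.re) :
    BoundedComposition (quadraticSymbol r c₀ c₁ a b) := by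
  lift r to ℕ+ using hr
  obtain ⟨C, hC⟩ := exists_tsum_quadExpCoeff_le_const ha hb (Real.log_pos one_lt_two) hab
  refine ⟨_, isCompositionOperator_synthesis (column r c₀ c₁ a b)
    (max ‖column r c₀ c₁ a b 1‖ C) (fun n => ?_) fun n s hs => eval_column r c₀ c₁ a b n hs⟩
  -- For `n = 1` the logarithm is 0, outside the range `L ≥ log 2` of the estimate.
  rcases eq_or_ne n 1 with rfl | hn
  · exact le_max_left _ _
  refine le_max_of_le_right ((norm_column_le r c₀ c₁ a b n).trans ?_)
  have h0 : 0 ≤ Real.log n := (Real.log_pos one_lt_two).le.trans (log_two_le_log hn)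
  have h := hC _ (log_two_le_log hn)
  have hC0 : 0 ≤ C := by
    have h1 : 0 ≤ ∑' k, ‖quadExpCoeff a b (Real.log n) k‖ := tsum_nonneg fun _ => norm_nonneg _
    exact nonneg_of_mul_nonneg_left (h1.trans h) (Real.exp_pos _)
  calc _ ≤ Real.exp (-(Real.log n * c₁.re)) *
        (C * Real.exp (Real.log n * (a ^ 2 / (8 * b) + b))) := by gcongr
    _ = C * Real.exp (Real.log n * (a ^ 2 / (8 * b) + b - c₁.re)) := by
        rw [mul_left_comm, ← Real.exp_add]
        congr 2
        ring
    _ ≤ C * 1 := by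
        gcongr
        rw [Real.exp_le_one_iff]
        exact mul_nonpos_of_nonneg_of_nonpos h0 (by linarith)
    _ = C := mul_one C

theorem tendsto_pnat_val_atTop : Tendsto (fun n : ℕ+ => (n : ℕ)) cofinite atTop := by
  rw [← Nat.cofinite_eq_atTop]
  exact PNat.coe_injective.tendsto_cofinite

theorem compactComposition_of_lt {r : ℕ} (hr : 0 < r) (c₀ : ℕ) {c₁ : ℂ} {a b : ℝ}
    (hb : 0 < b) (hc : a ^ 2 / (8 * b) + b < c₁.re) :
    CompactComposition (quadraticSymbol r c₀ c₁ a b) := by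
  lift r to ℕ+ using hr
  obtain ⟨C, hC0, hC⟩ := exists_tsum_quadExpCoeff_le_sqrt (a := a) hb (Real.log_pos one_lt_two)
  set ε := c₁.re - (a ^ 2 / (8 * b) + b) with hε
  have hε0 : 0 < ε := sub_pos.2 hc
  have hbound : ∀ n : ℕ+, n ≠ 1 → ‖column r c₀ c₁ a b n‖ ≤
      √(C * √(Real.log n)) * Real.exp (-ε * Real.log n) := fun n hn => by
    refine (norm_column_le r c₀ c₁ a b n).trans ?_
    calc _ ≤ Real.exp (-(Real.log n * c₁.re)) * (√(C * √(Real.log n)) *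
          Real.exp (Real.log n * (a ^ 2 / (8 * b) + b))) :=
          mul_le_mul_of_nonneg_left (hC _ (log_two_le_log hn)) (Real.exp_pos _).le
      _ = _ := by
          rw [mul_left_comm, ← Real.exp_add]
          congr 2
          rw [hε]
          ring
  have hlim : Tendsto (fun n => ‖column r c₀ c₁ a b n‖) cofinite (𝓝 0) := by
    have h1 : Tendsto (fun L : ℝ => √(C * √L) * Real.exp (-ε * L)) atTop (𝓝 0) := by
      have h2 := (tendsto_rpow_mul_exp_neg_mul_atTop_nhds_zero (1 / 4) ε hε0).const_mul (√C)
      rw [mul_zero] at h2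
      refine h2.congr' ?_
      filter_upwards [eventually_ge_atTop 0] with L hL
      rw [Real.sqrt_mul hC0, mul_assoc]
      congr 2
      rw [Real.sqrt_eq_rpow, Real.sqrt_eq_rpow, ← Real.rpow_mul hL]
      norm_num
    have h3 := h1.comp (Real.tendsto_log_atTop.comp
      (tendsto_natCast_atTop_atTop.comp tendsto_pnat_val_atTop))
    refine squeeze_zero' (Eventually.of_forall fun _ => norm_nonneg _) ?_ h3
    filter_upwards [(Set.finite_singleton (1 : ℕ+)).compl_mem_cofinite] with n hn
    exact hbound n hn
  obtain ⟨K, hK⟩ : ∃ K, ∀ n, ‖column r c₀ c₁ a b n‖ ≤ K := by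
    have hfin : {n | ¬ ‖column r c₀ c₁ a b n‖ < 1}.Finite := by
      have := hlim.eventually (gt_mem_nhds one_pos)
      simpa [eventually_cofinite] using this
    obtain ⟨K, hK⟩ := (hfin.image fun n => ‖column r c₀ c₁ a b n‖).bddAbove
    refine ⟨max K 1, fun n => ?_⟩
    by_cases hn : ‖column r c₀ c₁ a b n‖ < 1
    · exact le_max_of_le_right hn.le
    · exact le_max_of_le_left (hK ⟨n, hn, rfl⟩)
  exact ⟨_, isCompositionOperator_synthesis (column r c₀ c₁ a b) K hK
    fun n s hs => eval_column r c₀ c₁ a b n hs, isCompactOperator_synthesis _ K hK hlim⟩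

end Sufficiency

/-! ### Boundary tests -/

section Necessity

open scoped Real

/-- The point `s` with real part `σ` at which `r ^ (-s)` has argument `θ`. -/
noncomputable def circlePoint (r : ℕ+) (σ θ : ℝ) : ℂ :=
  σ - ((θ / Real.log r : ℝ) : ℂ) * Complex.I

@[simp] theorem circlePoint_re (r : ℕ+) (σ θ : ℝ) : (circlePoint r σ θ).re = σ := by
  simp [circlePoint, -Complex.ofReal_div]

theorem natCast_cpow_neg_circlePoint (r m : ℕ+) (σ θ : ℝ) :
    ((m : ℕ) : ℂ) ^ (-circlePoint r σ θ) = ((Real.exp (-(Real.log m * σ)) : ℝ) : ℂ) *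
      Complex.exp ((θ * (Real.log m / Real.log r) : ℝ) * Complex.I) := by
  rw [natCast_cpow_neg_eq_exp, Complex.ofReal_exp, ← Complex.exp_add, circlePoint]
  congr 1
  push_cast
  ring

theorem base_cpow_neg_circlePoint {r : ℕ+} (hr : 2 ≤ r) (σ θ : ℝ) :
    ((r : ℕ) : ℂ) ^ (-circlePoint r σ θ) = ((Real.exp (-(Real.log r * σ)) : ℝ) : ℂ) *
      Complex.exp (θ * Complex.I) := by
  have : Real.log r ≠ 0 := (Real.log_pos (by exact_mod_cast hr)).ne'
  rw [natCast_cpow_neg_circlePoint, div_self this, mul_one]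

theorem continuous_quadraticSymbol_circlePoint (r : ℕ+) (c₀ : ℕ) (c₁ : ℂ) (a b θ : ℝ) :
    Continuous fun σ : ℝ => quadraticSymbol r c₀ c₁ a b (circlePoint r σ θ) := by
  have h0 : ((r : ℕ) : ℂ) ≠ 0 := by exact_mod_cast r.ne_zero
  have hp : Continuous fun σ : ℝ => circlePoint r σ θ := by unfold circlePoint; fun_prop
  have h2 : Continuous fun σ : ℝ => ((r : ℕ) : ℂ) ^ (-circlePoint r σ θ) := hp.neg.const_cpow (Or.inl h0)
  have h3 : Continuous fun σ : ℝ => ((r : ℕ) : ℂ) ^ (-(2 * circlePoint r σ θ)) :=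
    (continuous_const.mul hp).neg.const_cpow (Or.inl h0)
  unfold quadraticSymbol
  fun_prop

theorem continuous_cpow_quadraticSymbol (r n : ℕ+) (c₀ : ℕ) (c₁ : ℂ) (a b θ : ℝ) :
    Continuous fun σ : ℝ =>
      ((n : ℕ) : ℂ) ^ (-quadraticSymbol r c₀ c₁ a b (circlePoint r σ θ)) :=
  (continuous_quadraticSymbol_circlePoint r c₀ c₁ a b θ).neg.const_cpow
    (Or.inl (by exact_mod_cast n.ne_zero))

theorem eval_map_monomial {φ : ℂ → ℂ} {T : WienerDirichlet →L[ℂ] WienerDirichlet}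
    (hT : IsCompositionOperator φ T) (n : ℕ+) {s : ℂ} (hs : 0 < s.re) :
    (T (monomial n)).eval s = ((n : ℕ) : ℂ) ^ (-φ s) :=
  (hT (monomial n) s hs).unique (hasSum_term_monomial n _)

/-- Testing a composition operator against a trigonometric polynomial at boundary points. -/
theorem norm_sum_cpow_le {r : ℕ+} {c₀ : ℕ} {c₁ : ℂ} {a b : ℝ}
    {T : WienerDirichlet →L[ℂ] WienerDirichlet}
    (hT : IsCompositionOperator (quadraticSymbol r c₀ c₁ a b) T) (n : ℕ+)
    {ι : Type*} (I : Finset ι) (α : ι → ℂ) (θ : ι → ℝ) {B : ℝ} (hB0 : 0 ≤ B)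
    (hB : ∀ x : ℝ, ‖∑ i ∈ I, α i * Complex.exp ((θ i * x : ℝ) * Complex.I)‖ ≤ B) :
    ‖∑ i ∈ I, α i *
      ((n : ℕ) : ℂ) ^ (-quadraticSymbol r c₀ c₁ a b (circlePoint r 0 (θ i)))‖ ≤ ‖T‖ * B := by
  have hcont : Continuous fun σ : ℝ => ‖∑ i ∈ I, α i *
      ((n : ℕ) : ℂ) ^ (-quadraticSymbol r c₀ c₁ a b (circlePoint r σ (θ i)))‖ :=
    (continuous_finsetSum _ fun i _ =>
      continuous_const.mul (continuous_cpow_quadraticSymbol r n c₀ c₁ a b (θ i))).norm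
  -- The operator identity holds only for `re s > 0`, so the test is made at `σ > 0` and then `σ →
  -- 0⁺`.
  refine le_of_tendsto ((hcont.tendsto 0).mono_left (nhdsWithin_le_nhds (s := Set.Ioi 0))) ?_
  filter_upwards [self_mem_nhdsWithin] with σ hσ
  have hσ' : 0 < σ := hσ
  have h := norm_sum_eval_le (T (monomial n)) I α (fun i => circlePoint r σ (θ i))
    (by simpa using fun _ => hσ'.le) (B := B) fun m => by
      -- All points share the real part `σ`, so a common damping factor comes out, leaving the
      -- trigonometric sum at `x = log m / log r`.
      have e : ∑ i ∈ I, α i * ((m : ℕ) : ℂ) ^ (-circlePoint r σ (θ i)) =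
          ((Real.exp (-(Real.log m * σ)) : ℝ) : ℂ) * ∑ i ∈ I, α i *
            Complex.exp ((θ i * (Real.log m / Real.log r) : ℝ) * Complex.I) := by
        rw [Finset.mul_sum]
        refine Finset.sum_congr rfl fun i _ => ?_
        rw [natCast_cpow_neg_circlePoint]
        ring
      rw [e, norm_mul, Complex.norm_real, Real.norm_eq_abs, Real.abs_exp]
      refine (mul_le_of_le_one_left (norm_nonneg _) ?_).trans (hB _)
      rw [Real.exp_le_one_iff, neg_nonpos]
      exact mul_nonneg (Real.log_nonneg (Nat.one_le_cast.2 m.pos)) hσ'.le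
  have e : ∑ i ∈ I, α i * (T (monomial n)).eval (circlePoint r σ (θ i)) = ∑ i ∈ I, α i *
      ((n : ℕ) : ℂ) ^ (-quadraticSymbol r c₀ c₁ a b (circlePoint r σ (θ i))) :=
    Finset.sum_congr rfl fun i _ => by rw [eval_map_monomial hT n (by simpa using hσ')]
  rw [e] at h
  refine h.trans (mul_le_mul_of_nonneg_right ?_ hB0)
  simpa [norm_monomial] using T.le_opNorm (monomial n)

/-- Written so that at `σ = 0` only the distance to the threshold remains, while for `σ > 0` the
other terms are nonnegative and the last is positive. -/
theorem re_quadraticSymbol_circlePoint {r : ℕ+} (hr : 2 ≤ r) (c₀ : ℕ) (c₁ : ℂ) {a b : ℝ}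
    (hb : 0 < b) {θ : ℝ} (hθ : Real.cos θ = -a / (4 * b)) (σ : ℝ) :
    (quadraticSymbol r c₀ c₁ a b (circlePoint r σ θ)).re =
      c₁.re - (a ^ 2 / (8 * b) + b) + c₀ * σ +
        a ^ 2 / (8 * b) * (1 - Real.exp (-(Real.log r * σ))) ^ 2 +
        b * (1 - Real.exp (-(Real.log r * σ)) ^ 2) := by
  have h : ((r : ℕ) : ℂ) ^ (-(2 * circlePoint r σ θ)) =
      (((r : ℕ) : ℂ) ^ (-circlePoint r σ θ)) ^ 2 := by
    rw [← Complex.cpow_nat_mul]; congr 1; push_cast; ring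
  rw [quadraticSymbol, h, base_cpow_neg_circlePoint hr, mul_pow, ← Complex.exp_nat_mul]
  have h2 : ((2 : ℕ) : ℂ) * (θ * Complex.I) = ((2 * θ : ℝ) : ℂ) * Complex.I := by
    push_cast; ring
  have h3 : (c₀ : ℂ) = ((c₀ : ℝ) : ℂ) := by push_cast; rfl
  rw [h2, h3, ← Complex.ofReal_pow]
  simp only [Complex.add_re, Complex.re_ofReal_mul, Complex.exp_ofReal_mul_I_re,
    Real.cos_two_mul, hθ, circlePoint_re]
  field_simp
  ring

theorem exists_cos_eq {a b : ℝ} (ha : 0 < a) (hb : 0 < b) (hab : a ≤ 4 * b) :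
    ∃ θ : ℝ, Real.cos θ = -a / (4 * b) := by
  refine ⟨Real.arccos (-a / (4 * b)), Real.cos_arccos ?_ ?_⟩
  · rw [le_div_iff₀ (by positivity)]
    linarith
  · rw [div_le_iff₀ (by positivity)]
    linarith

theorem tendsto_log_succPNat : Tendsto (fun k : ℕ => Real.log (k.succPNat : ℕ)) atTop atTop :=
  Real.tendsto_log_atTop.comp (tendsto_natCast_atTop_atTop.comp (tendsto_add_atTop_nat 1))

theorem le_re_of_boundedComposition {r : ℕ+} (hr : 2 ≤ r) {c₀ : ℕ} {c₁ : ℂ} {a b : ℝ}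
    (ha : 0 < a) (hb : 0 < b) (hab : a ≤ 4 * b)
    (h : BoundedComposition (quadraticSymbol r c₀ c₁ a b)) : a ^ 2 / (8 * b) + b ≤ c₁.re := by
  obtain ⟨T, hT⟩ := h
  obtain ⟨θ, hθ⟩ := exists_cos_eq ha hb hab
  by_contra! hlt
  have key (n : ℕ+) : Real.exp (Real.log n * (a ^ 2 / (8 * b) + b - c₁.re)) ≤ ‖T‖ := by
    have h1 := norm_sum_cpow_le hT n (Finset.univ : Finset Unit) (fun _ => 1) (fun _ => θ)
      zero_le_one fun x => by simp [Complex.norm_exp_ofReal_mul_I, -Complex.ofReal_mul]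
    simp only [Finset.univ_unique, Finset.sum_singleton, one_mul, mul_one] at h1
    rw [norm_natCast_cpow_neg, re_quadraticSymbol_circlePoint hr c₀ c₁ hb hθ] at h1
    refine le_trans (le_of_eq ?_) h1
    congr 1
    simp
    ring
  have h2 : Tendsto (fun k : ℕ => Real.exp (Real.log (k.succPNat : ℕ) *
      (a ^ 2 / (8 * b) + b - c₁.re))) atTop atTop :=
    Real.tendsto_exp_atTop.comp (tendsto_log_succPNat.atTop_mul_const (sub_pos.2 hlt))
  obtain ⟨k, hk⟩ := (h2.eventually_gt_atTop ‖T‖).exists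
  exact absurd (key k.succPNat) (not_le.2 hk)

/-- At the threshold, a limit point `g` of the images of monomials vanishes along the ray ending at
the extremal boundary point, whereas each image has modulus tending to 1 there. So every image stays
at distance at least 1 from `g`. -/
theorem lt_re_of_compactComposition {r : ℕ+} (hr : 2 ≤ r) {c₀ : ℕ} {c₁ : ℂ} {a b : ℝ}
    (ha : 0 < a) (hb : 0 < b) (hab : a ≤ 4 * b)
    (h : CompactComposition (quadraticSymbol r c₀ c₁ a b)) : a ^ 2 / (8 * b) + b < c₁.re := by
  obtain ⟨T, hT, hcomp⟩ := h
  refine lt_of_le_of_ne (le_re_of_boundedComposition hr ha hb hab ⟨T, hT⟩) fun heq => ?_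
  obtain ⟨θ, hθ⟩ := exists_cos_eq ha hb hab
  have hlogr : 0 < Real.log r := Real.log_pos (by exact_mod_cast hr)
  obtain ⟨g, -, ψ, hψ, hlim⟩ := (hcomp.isCompact_closure_image_closedBall 1).tendsto_subseq
    (x := fun k : ℕ => T (monomial k.succPNat))
    fun k => subset_closure ⟨_, by simp [norm_monomial], rfl⟩
  have hg : ∀ σ > 0, g.eval (circlePoint r σ θ) = 0 := fun σ hσ => by
    have hre : 0 < (circlePoint r σ θ).re := by simpa
    have h1 : Tendsto (fun k => (T (monomial (ψ k).succPNat)).eval (circlePoint r σ θ)) atTop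
        (𝓝 (g.eval (circlePoint r σ θ))) :=
      ((evalCLM _ hre.le).continuous.tendsto g).comp hlim
    refine tendsto_nhds_unique h1 (tendsto_zero_iff_norm_tendsto_zero.2 ?_)
    simp_rw [eval_map_monomial hT _ hre, norm_natCast_cpow_neg]
    have hpos : 0 < (quadraticSymbol r c₀ c₁ a b (circlePoint r σ θ)).re := by
      rw [re_quadraticSymbol_circlePoint hr c₀ c₁ hb hθ, ← heq]
      have h2 : Real.exp (-(Real.log r * σ)) < 1 := by
        rw [Real.exp_lt_one_iff, neg_lt_zero]
        positivity
      have h3 := Real.exp_pos (-(Real.log r * σ))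
      have h4 : 0 < b * (1 - Real.exp (-(Real.log r * σ)) ^ 2) :=
        mul_pos hb (by nlinarith)
      have h5 : 0 ≤ a ^ 2 / (8 * b) * (1 - Real.exp (-(Real.log r * σ))) ^ 2 := by positivity
      have h6 : 0 ≤ (c₀ : ℝ) * σ := by positivity
      linarith
    exact Real.tendsto_exp_neg_atTop_nhds_zero.comp
      ((tendsto_log_succPNat.comp hψ.tendsto_atTop).atTop_mul_const hpos)
  have hone (n : ℕ+) : 1 ≤ ‖T (monomial n) - g‖ := by
    have hc := (continuous_cpow_quadraticSymbol r n c₀ c₁ a b θ).norm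
    have h0 : ‖((n : ℕ) : ℂ) ^ (-quadraticSymbol r c₀ c₁ a b (circlePoint r 0 θ))‖ = 1 := by
      rw [norm_natCast_cpow_neg, re_quadraticSymbol_circlePoint hr c₀ c₁ hb hθ, ← heq]
      simp
    rw [← h0]
    refine le_of_tendsto ((hc.tendsto 0).mono_left (nhdsWithin_le_nhds (s := Set.Ioi 0))) ?_
    filter_upwards [self_mem_nhdsWithin] with σ hσ
    have hre : 0 < (circlePoint r σ θ).re := by simpa using hσ
    have h1 := norm_eval_le (T (monomial n) - g) hre.le
    rwa [← evalCLM_apply _ hre.le, map_sub, evalCLM_apply, evalCLM_apply, hg σ hσ, sub_zero,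
      eval_map_monomial hT n hre] at h1
  have h1 := tendsto_iff_norm_sub_tendsto_zero.1 hlim
  obtain ⟨k, hk⟩ := (h1.eventually (gt_mem_nhds one_pos)).exists
  exact absurd (hone _) (not_le.2 hk)

end Necessity

/-! ### The degenerate case `a = 4b` -/

section Critical

open scoped Real ComplexConjugate

/-- Parseval's identity for a unimodular vector and the `N × N` Fourier matrix. -/
theorem sum_norm_sq_fourierMatrix {N : ℕ} {ζ : ℂ} (hζ : IsPrimitiveRoot ζ N)
    (hN : N ≠ 0) {x : ℕ → ℂ} (hx : ∀ u, ‖x u‖ = 1) :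
    ∑ v ∈ Finset.range N, ‖∑ u ∈ Finset.range N, x u * ζ ^ (u * v)‖ ^ 2 = (N : ℝ) ^ 2 := by
  have hζ1 : ‖ζ‖ = 1 := hζ.norm'_eq_one hN
  have hunit (w : ℂ) (hw : ‖w‖ = 1) : w * conj w = 1 := by
    rw [Complex.mul_conj, Complex.normSq_eq_norm_sq, hw]; simp
  have hgeom (u u' : ℕ) (hu : u < N) (hu' : u' < N) :
      ∑ v ∈ Finset.range N, (ζ ^ u * conj (ζ ^ u')) ^ v = if u = u' then (N : ℂ) else 0 := by
    split_ifs with h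
    · subst h
      rw [hunit _ (by simp [hζ1])]
      simp
    · have h1 : ζ ^ u * conj (ζ ^ u') ≠ 1 := fun h1 => h (hζ.pow_inj hu hu' (by
        calc ζ ^ u = (ζ ^ u * conj (ζ ^ u')) * ζ ^ u' := by
              rw [mul_assoc, mul_comm (conj _), hunit _ (by simp [hζ1]), mul_one]
          _ = ζ ^ u' := by rw [h1, one_mul]))
      have h2 := geom_sum_mul (ζ ^ u * conj (ζ ^ u')) N
      have h3 : (ζ ^ u * conj (ζ ^ u')) ^ N = 1 := by
        rw [mul_pow, ← map_pow, ← pow_mul, ← pow_mul, mul_comm u, mul_comm u', pow_mul, pow_mul,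
          hζ.pow_eq_one]
        simp
      rw [h3, sub_self, mul_eq_zero] at h2
      exact h2.resolve_right (sub_ne_zero.2 h1)
  have hC : ((∑ v ∈ Finset.range N, ‖∑ u ∈ Finset.range N, x u * ζ ^ (u * v)‖ ^ 2 : ℝ) : ℂ)
      = (N : ℂ) ^ 2 := by
    push_cast
    calc _ = ∑ v ∈ Finset.range N, ∑ u ∈ Finset.range N, ∑ u' ∈ Finset.range N,
          x u * conj (x u') * (ζ ^ u * conj (ζ ^ u')) ^ v := by
          refine Finset.sum_congr rfl fun v _ => ?_
          rw [← Complex.mul_conj', map_sum, Finset.sum_mul_sum]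
          refine Finset.sum_congr rfl fun u _ => Finset.sum_congr rfl fun u' _ => ?_
          rw [map_mul, mul_pow, ← map_pow, ← pow_mul, ← pow_mul]
          ring
      _ = ∑ u ∈ Finset.range N, ∑ u' ∈ Finset.range N, x u * conj (x u') *
          ∑ v ∈ Finset.range N, (ζ ^ u * conj (ζ ^ u')) ^ v := by
          rw [Finset.sum_comm]
          refine Finset.sum_congr rfl fun u _ => ?_
          rw [Finset.sum_comm]
          simp_rw [Finset.mul_sum]
      _ = ∑ u ∈ Finset.range N, ∑ u' ∈ Finset.range N,
            if u = u' then x u * conj (x u') * N else 0 := by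
          refine Finset.sum_congr rfl fun u hu => Finset.sum_congr rfl fun u' hu' => ?_
          rw [hgeom u u' (Finset.mem_range.1 hu) (Finset.mem_range.1 hu'), mul_ite, mul_zero]
      _ = ∑ u ∈ Finset.range N, (N : ℂ) := by
          refine Finset.sum_congr rfl fun u hu => ?_
          rw [Finset.sum_ite_eq, if_pos hu, hunit _ (hx u), one_mul]
      _ = _ := by simp [sq]
  exact_mod_cast hC

/-- The triangle inequality over rows, then Cauchy–Schwarz and Parseval, save `√N` over the trivial
bound `N²`. -/
theorem norm_bilinear_fourierMatrix_le {N : ℕ} {ζ : ℂ} (hζ : IsPrimitiveRoot ζ N)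
    (hN : N ≠ 0) {x : ℕ → ℂ} (hx : ∀ u, ‖x u‖ = 1) :
    ‖∑ p ∈ Finset.range N ×ˢ Finset.range N, x p.1 * x p.2 * ζ ^ (p.1 * p.2)‖ ≤
      √((N : ℝ) ^ 3) := by
  refine Real.le_sqrt_of_sq_le ?_
  have h1 : ∑ p ∈ Finset.range N ×ˢ Finset.range N, x p.1 * x p.2 * ζ ^ (p.1 * p.2) =
      ∑ v ∈ Finset.range N, x v * ∑ u ∈ Finset.range N, x u * ζ ^ (u * v) := by
    rw [Finset.sum_product_right]
    simp_rw [Finset.mul_sum]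
    exact Finset.sum_congr rfl fun v _ => Finset.sum_congr rfl fun u _ => by ring
  have h2 : ‖∑ p ∈ Finset.range N ×ˢ Finset.range N, x p.1 * x p.2 * ζ ^ (p.1 * p.2)‖ ≤
      ∑ v ∈ Finset.range N, ‖∑ u ∈ Finset.range N, x u * ζ ^ (u * v)‖ := by
    rw [h1]
    refine (norm_sum_le _ _).trans_eq (Finset.sum_congr rfl fun v _ => ?_)
    rw [norm_mul, hx, one_mul]
  calc _ ≤ (∑ v ∈ Finset.range N, ‖∑ u ∈ Finset.range N, x u * ζ ^ (u * v)‖) ^ 2 := by gcongr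
    _ ≤ (Finset.range N).card *
        ∑ v ∈ Finset.range N, ‖∑ u ∈ Finset.range N, x u * ζ ^ (u * v)‖ ^ 2 :=
        sq_sum_le_card_mul_sum_sq
    _ = (N : ℝ) ^ 3 := by
        rw [sum_norm_sq_fourierMatrix hζ hN hx, Finset.card_range]
        ring

/-- The exponent `4 exp (i t) - exp (2 i t) - 3`, which vanishes to third order at `t = 0`
up to its linear term. -/
noncomputable def flatPhase (t : ℝ) : ℂ :=
  4 * Complex.exp (t * Complex.I) - Complex.exp (t * Complex.I) ^ 2 - 3

theorem flatPhase_eq (t : ℝ) : flatPhase t =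
    ((-2 * (1 - Real.cos t) ^ 2 : ℝ) : ℂ) +
      ((4 * Real.sin t - Real.sin (2 * t) : ℝ) : ℂ) * Complex.I := by
  have h := Complex.sin_sq_add_cos_sq (t : ℂ)
  rw [flatPhase, Complex.exp_mul_I]
  push_cast
  rw [Complex.sin_two_mul]
  linear_combination h - Complex.sin t ^ 2 * Complex.I_sq

/-- The loss of modulus is quartic in `t`, so on suitable scales the cubic phase is visible before
the decay is. -/
theorem norm_flatPhase_sub_le {t : ℝ} (ht : |t| ≤ 1 / 2) :
    ‖flatPhase t - ((2 * t + 2 / 3 * t ^ 3 : ℝ) : ℂ) * Complex.I‖ ≤ 3 * t ^ 4 := by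
  have e : flatPhase t - ((2 * t + 2 / 3 * t ^ 3 : ℝ) : ℂ) * Complex.I =
      ((-2 * (1 - Real.cos t) ^ 2 : ℝ) : ℂ) +
      ((4 * (Real.sin t - (t - t ^ 3 / 6)) - (Real.sin (2 * t) - (2 * t - (2 * t) ^ 3 / 6)) : ℝ) : ℂ)
        * Complex.I := by
    rw [flatPhase_eq]; push_cast; ring
  have h1 := Real.sin_bound (x := t) (by linarith)
  have h2 := Real.sin_bound (x := 2 * t) (by rw [abs_mul, abs_two]; linarith)
  have e4 : |2 * t| ^ 4 = 16 * t ^ 4 := by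
    rw [abs_mul, abs_two, mul_pow, Even.pow_abs (by decide)]; norm_num
  have h1' : |t| ^ 5 ≤ t ^ 4 := by
    rw [← Even.pow_abs (show Even 4 by decide) t]
    exact pow_le_pow_of_le_one (abs_nonneg t) (by linarith) (by norm_num)
  have h2' : |2 * t| ^ 5 ≤ 16 * t ^ 4 := by
    rw [← e4]
    exact pow_le_pow_of_le_one (abs_nonneg _) (by rw [abs_mul, abs_two]; linarith) (by norm_num)
  have h3 : |-2 * (1 - Real.cos t) ^ 2| ≤ t ^ 4 / 2 := by
    have h4 := Real.one_sub_sq_div_two_le_cos (x := t)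
    have h5 := Real.cos_le_one t
    rw [abs_mul, abs_neg, abs_two, abs_of_nonneg (sq_nonneg _)]
    nlinarith [pow_le_pow_left₀ (sub_nonneg.2 h5) (show 1 - Real.cos t ≤ t ^ 2 / 2 by linarith) 2]
  rw [e]
  refine (norm_add_le _ _).trans ?_
  rw [norm_mul, Complex.norm_I, mul_one, Complex.norm_real, Complex.norm_real, Real.norm_eq_abs,
    Real.norm_eq_abs]
  have h6 := abs_sub (4 * (Real.sin t - (t - t ^ 3 / 6)))
    (Real.sin (2 * t) - (2 * t - (2 * t) ^ 3 / 6))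
  rw [abs_mul, abs_of_pos (show (0 : ℝ) < 4 by norm_num)] at h6
  have : 0 ≤ t ^ 4 := by positivity
  linarith

/-- The deviation of the rescaled flat phase from a quadratic polynomial in `j`. -/
noncomputable def phaseError (b κ : ℝ) (j : ℕ) (η : ℝ) : ℂ :=
  ((b * η⁻¹ ^ 20 : ℝ) : ℂ) * flatPhase (η ^ 6 + j * (κ * η ^ 7)) -
    ((b * (2 * η⁻¹ ^ 14 + 2 / 3 * η⁻¹ ^ 2) + j * (b * κ * (2 * η⁻¹ ^ 13 + 2 * η⁻¹)) +
      2 * b * κ ^ 2 * j ^ 2 : ℝ) : ℂ) * Complex.I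

/-- With `L = η⁻²⁰`, centre `η⁶` and step `κη⁷`, the quartic error is of order `L η²⁴ = η⁴` and the
`j³` term of order `L η²¹ = η`, while the `j²` coefficient, of order `L η⁶ η¹⁴`, stays fixed. -/
theorem tendsto_phaseError {b : ℝ} (hb : 0 < b) (κ : ℝ) (j : ℕ) :
    Tendsto (phaseError b κ j) (𝓝[>] 0) (𝓝 0) := by
  have hlim : Tendsto (fun η : ℝ => 3 * b * η ^ 4 * (1 + j * κ * η) ^ 4 +
      |2 / 3 * b * (j * κ) ^ 3 * η|) (𝓝[>] 0) (𝓝 0) := by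
    have hc : Continuous fun η : ℝ => 3 * b * η ^ 4 * (1 + j * κ * η) ^ 4 +
        |2 / 3 * b * (j * κ) ^ 3 * η| := by fun_prop
    simpa using (hc.tendsto 0).mono_left (nhdsWithin_le_nhds (s := Set.Ioi 0))
  have hsmall : ∀ᶠ η : ℝ in 𝓝[>] 0, |η ^ 6 + j * (κ * η ^ 7)| < 1 / 2 := by
    have hc : Continuous fun η : ℝ => |η ^ 6 + j * (κ * η ^ 7)| := by fun_prop
    have := (hc.tendsto 0).mono_left (nhdsWithin_le_nhds (s := Set.Ioi 0))
    exact this.eventually (gt_mem_nhds (by norm_num))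
  refine squeeze_zero_norm' ?_ hlim
  filter_upwards [hsmall, self_mem_nhdsWithin] with η ht hη
  have hη0 : (0 : ℝ) < η := hη
  set t := η ^ 6 + j * (κ * η ^ 7) with htdef
  have e : phaseError b κ j η = ((b * η⁻¹ ^ 20 : ℝ) : ℂ) *
      (flatPhase t - ((2 * t + 2 / 3 * t ^ 3 : ℝ) : ℂ) * Complex.I) +
      ((2 / 3 * b * (j * κ) ^ 3 * η : ℝ) : ℂ) * Complex.I := by
    have hr : b * η⁻¹ ^ 20 * (2 * t + 2 / 3 * t ^ 3) =
        b * (2 * η⁻¹ ^ 14 + 2 / 3 * η⁻¹ ^ 2) + j * (b * κ * (2 * η⁻¹ ^ 13 + 2 * η⁻¹)) +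
          2 * b * κ ^ 2 * j ^ 2 + 2 / 3 * b * (j * κ) ^ 3 * η := by
      rw [htdef]
      field_simp
      ring
    have hrC := congrArg (fun x : ℝ => (x : ℂ) * Complex.I) hr
    rw [phaseError, ← htdef]
    push_cast at hrC ⊢
    linear_combination hrC
  rw [e]
  refine (norm_add_le _ _).trans (add_le_add ?_ ?_)
  · rw [norm_mul, Complex.norm_real, Real.norm_eq_abs, abs_of_pos (by positivity)]
    calc _ ≤ b * η⁻¹ ^ 20 * (3 * t ^ 4) := by
          gcongr
          exact norm_flatPhase_sub_le ht.le
      _ = _ := by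
          rw [htdef]
          field_simp
  · rw [norm_mul, Complex.norm_I, mul_one, Complex.norm_real, Real.norm_eq_abs]

theorem quadExp_four_mul (b L t : ℝ) :
    quadExp (4 * b) b L (Complex.exp ((π + t : ℝ) * Complex.I)) =
      Complex.exp (3 * b * L) * Complex.exp (((b * L : ℝ) : ℂ) * flatPhase t) := by
  have h : Complex.exp ((π + t : ℝ) * Complex.I) = -Complex.exp (t * Complex.I) := by
    push_cast
    rw [add_mul, Complex.exp_add, Complex.exp_pi_mul_I, neg_one_mul]
  rw [quadExp, h, ← Complex.exp_add, flatPhase]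
  congr 1
  push_cast
  ring

/-- Expanding `(u + v)²`: the cross term is the Fourier kernel, the rest splits into unimodular
factors. -/
theorem exp_neg_quadratic_mul (N : ℕ) (ρ : ℂ) (u v : ℕ) :
    Complex.exp (-(π / N * (u + v : ℕ) ^ 2 * Complex.I)) * ρ ^ (u + v) =
      (Complex.exp (-(π / N * u ^ 2 * Complex.I)) * ρ ^ u) *
        (Complex.exp (-(π / N * v ^ 2 * Complex.I)) * ρ ^ v) *
        (Complex.exp (2 * π * Complex.I / N))⁻¹ ^ (u * v) := by
  have h : Complex.exp (-(π / N * (u + v : ℕ) ^ 2 * Complex.I)) =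
      Complex.exp (-(π / N * u ^ 2 * Complex.I)) * Complex.exp (-(π / N * v ^ 2 * Complex.I)) *
        (Complex.exp (2 * π * Complex.I / N))⁻¹ ^ (u * v) := by
    rw [← Complex.exp_neg, ← Complex.exp_nat_mul, ← Complex.exp_add, ← Complex.exp_add]
    congr 1
    push_cast
    ring
  rw [h, pow_add]
  ring

theorem sq_le_opNorm_mul_sqrt {r : ℕ+} (hr : 2 ≤ r) {c₀ : ℕ} {c₁ : ℂ} {b : ℝ} (hb : 0 < b)
    (hc : c₁.re = 3 * b) {T : WienerDirichlet →L[ℂ] WienerDirichlet}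
    (hT : IsCompositionOperator (quadraticSymbol r c₀ c₁ (4 * b) b) T) {N : ℕ} (hN : N ≠ 0) :
    (N : ℝ) ^ 2 ≤ ‖T‖ * √((N : ℝ) ^ 3) := by
  have hN0 : (0 : ℝ) < N := by exact_mod_cast Nat.pos_of_ne_zero hN
  -- Chosen so that the limiting quadratic phase is `π j²/N`.
  set κ : ℝ := √(π / (2 * b * N)) with hκ
  have hκ2 : 2 * b * κ ^ 2 = π / N := by
    rw [hκ, Real.sq_sqrt (by positivity)]
    field_simp
  set S := Finset.range N ×ˢ Finset.range N with hS
  have hlim : Tendsto (fun η : ℝ => ‖∑ p ∈ S, Complex.exp (phaseError b κ (p.1 + p.2) η)‖)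
      (𝓝[>] 0) (𝓝 ((N : ℝ) ^ 2)) := by
    have h1 : Tendsto (fun η : ℝ => ∑ p ∈ S, Complex.exp (phaseError b κ (p.1 + p.2) η))
        (𝓝[>] 0) (𝓝 (∑ p ∈ S, Complex.exp 0)) :=
      tendsto_finsetSum _ fun p _ => (tendsto_phaseError hb κ _).cexp
    have h2 : ‖∑ p ∈ S, Complex.exp 0‖ = (N : ℝ) ^ 2 := by simp [hS, sq]
    exact h2 ▸ h1.norm
  have hη : Tendsto (fun k : ℕ => (Real.log (k.succPNat : ℕ)) ^ (-(1 / 20) : ℝ)) atTop (𝓝[>] 0) := by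
    refine tendsto_nhdsWithin_iff.2
      ⟨(tendsto_rpow_neg_atTop (by norm_num)).comp tendsto_log_succPNat, ?_⟩
    filter_upwards [tendsto_log_succPNat.eventually_gt_atTop 0] with k hk
    exact Real.rpow_pos_of_pos hk _
  refine le_of_tendsto (hlim.comp hη) ?_
  filter_upwards [tendsto_log_succPNat.eventually_gt_atTop 0] with k hk
  set n : ℕ+ := k.succPNat
  set η : ℝ := (Real.log n) ^ (-(1 / 20) : ℝ) with hηdef
  have hL : Real.log n = η⁻¹ ^ 20 := by
    rw [hηdef, Real.rpow_neg hk.le, inv_inv, ← Real.rpow_natCast, ← Real.rpow_mul hk.le]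
    norm_num
  set θ : ℕ → ℝ := fun j => π + (η ^ 6 + j * (κ * η ^ 7)) with hθ
  -- The term `c₀ s` contributes only a phase linear in the angle; `A` and `D` collect the constant
  -- and linear phases in `j`.
  set ω : ℝ := c₀ * Real.log n / Real.log r with hω
  set A : ℝ := b * (2 * η⁻¹ ^ 14 + 2 / 3 * η⁻¹ ^ 2) - Real.log n * c₁.im + ω * (π + η ^ 6) with hA
  set D : ℝ := b * κ * (2 * η⁻¹ ^ 13 + 2 * η⁻¹) + ω * (κ * η ^ 7) with hD
  have hF (j : ℕ) :
      ((n : ℕ) : ℂ) ^ (-quadraticSymbol r c₀ c₁ (4 * b) b (circlePoint r 0 (θ j))) =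
        Complex.exp (A * Complex.I) * Complex.exp (D * Complex.I) ^ j *
        Complex.exp (π / N * j ^ 2 * Complex.I) * Complex.exp (phaseError b κ j η) := by
    rw [natCast_cpow_neg_quadraticSymbol, base_cpow_neg_circlePoint hr, mul_zero, neg_zero,
      Real.exp_zero, Complex.ofReal_one, one_mul, hθ, quadExp_four_mul, natCast_cpow_neg_eq_exp,
      natCast_cpow_neg_eq_exp, ← Complex.exp_nat_mul]
    simp only [← Complex.exp_add]
    congr 1
    have hc' : c₁ = ((3 * b : ℝ) : ℂ) + c₁.im * Complex.I := by
      rw [← hc]; exact (Complex.re_add_im c₁).symm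
    have hκC : 2 * (b : ℂ) * (κ : ℂ) ^ 2 = π / N := by exact_mod_cast congrArg ((↑) : ℝ → ℂ) hκ2
    rw [phaseError, ← hL, circlePoint, hA, hD, hω, ← hκC]
    conv_lhs => rw [hc']
    push_cast
    ring
  -- The coefficients conjugate the quadratic and linear phases, so the column sum has no
  -- cancellation in the limit.
  have htest := norm_sum_cpow_le hT n S
    (fun p => Complex.exp (-(π / N * (p.1 + p.2 : ℕ) ^ 2 * Complex.I)) *
      Complex.exp (-(D * Complex.I)) ^ (p.1 + p.2))
    (fun p => θ (p.1 + p.2)) (Real.sqrt_nonneg ((N : ℝ) ^ 3)) fun x => by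
      -- For each `x` the linear frequency goes into the unimodular vector, so the Fourier-matrix
      -- bound is uniform in `x`.
      set ρ : ℂ := Complex.exp (((κ * η ^ 7 * x - D : ℝ) : ℂ) * Complex.I) with hρ
      have hterm (p : ℕ × ℕ) : Complex.exp (-(π / N * (p.1 + p.2 : ℕ) ^ 2 * Complex.I)) *
          Complex.exp (-(D * Complex.I)) ^ (p.1 + p.2) *
          Complex.exp ((θ (p.1 + p.2) * x : ℝ) * Complex.I) =
          Complex.exp (((π + η ^ 6) * x : ℝ) * Complex.I) *
          ((Complex.exp (-(π / N * p.1 ^ 2 * Complex.I)) * ρ ^ p.1) *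
          (Complex.exp (-(π / N * p.2 ^ 2 * Complex.I)) * ρ ^ p.2) *
          (Complex.exp (2 * π * Complex.I / N))⁻¹ ^ (p.1 * p.2)) := by
        rw [← exp_neg_quadratic_mul, hρ, mul_left_comm, mul_assoc]
        congr 1
        simp only [← Complex.exp_nat_mul, ← Complex.exp_add]
        congr 1
        rw [hθ]
        push_cast
        ring
      simp_rw [hterm]
      rw [← Finset.mul_sum, norm_mul, Complex.norm_exp_ofReal_mul_I, one_mul]
      refine norm_bilinear_fourierMatrix_le
        (x := fun u => Complex.exp (-(π / N * u ^ 2 * Complex.I)) * ρ ^ u)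
        (Complex.isPrimitiveRoot_exp N hN).inv hN fun u => ?_
      have e : -((π : ℂ) / N * u ^ 2 * Complex.I) = ((-(π / N * u ^ 2) : ℝ) : ℂ) * Complex.I := by
        push_cast; ring
      rw [norm_mul, norm_pow, e, hρ, Complex.norm_exp_ofReal_mul_I, Complex.norm_exp_ofReal_mul_I]
      simp
  refine le_trans (le_of_eq ?_) htest
  have hsum : ∑ p ∈ S, Complex.exp (-(π / N * (p.1 + p.2 : ℕ) ^ 2 * Complex.I)) *
      Complex.exp (-(D * Complex.I)) ^ (p.1 + p.2) *
      ((n : ℕ) : ℂ) ^ (-quadraticSymbol r c₀ c₁ (4 * b) b (circlePoint r 0 (θ (p.1 + p.2)))) =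
      Complex.exp (A * Complex.I) *
        ∑ p ∈ S, Complex.exp (phaseError b κ (p.1 + p.2) η) := by
    rw [Finset.mul_sum]
    refine Finset.sum_congr rfl fun p _ => ?_
    rw [hF]
    simp only [← Complex.exp_nat_mul, ← Complex.exp_add]
    congr 1
    ring
  rw [hsum, norm_mul, Complex.norm_exp_ofReal_mul_I, one_mul]
  rfl

/-- Here `3b` is the threshold for `a = 4b`; any `N > ‖T‖²` contradicts `sq_le_opNorm_mul_sqrt`. -/
theorem not_boundedComposition_of_eq {r : ℕ+} (hr : 2 ≤ r) {c₀ : ℕ} {c₁ : ℂ} {b : ℝ} (hb : 0 < b)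
    (hc : c₁.re = 3 * b) : ¬ BoundedComposition (quadraticSymbol r c₀ c₁ (4 * b) b) := by
  rintro ⟨T, hT⟩
  obtain ⟨N, hN⟩ := exists_nat_gt (‖T‖ ^ 2)
  have hN0 : (0 : ℝ) < N := (sq_nonneg _).trans_lt hN
  have h := sq_le_opNorm_mul_sqrt hr hb hc hT (N := N) (by exact_mod_cast hN0.ne')
  have h2 := pow_le_pow_left₀ (by positivity) h 2
  rw [mul_pow, Real.sq_sqrt (by positivity)] at h2
  have h3 : ‖T‖ ^ 2 * (N : ℝ) ^ 3 < N * (N : ℝ) ^ 3 := by gcongr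
  nlinarith

end Critical

end WienerDirichlet

theorem proposition2p6 (r c₀ : ℕ) (hr : 2 ≤ r) (c₁ : ℂ) (a b : ℝ) (ha : 0 < a) (hb : 0 < b) :
    (a ^ 2 / (8 * b) + b < c₁.re →
      BoundedComposition (quadraticSymbol r c₀ c₁ a b) ∧
        CompactComposition (quadraticSymbol r c₀ c₁ a b)) ∧
    (a ≤ 4 * b →
      (BoundedComposition (quadraticSymbol r c₀ c₁ a b) → a ^ 2 / (8 * b) + b ≤ c₁.re) ∧
      (CompactComposition (quadraticSymbol r c₀ c₁ a b) → a ^ 2 / (8 * b) + b < c₁.re)) ∧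
    (c₁.re = a ^ 2 / (8 * b) + b →
      (BoundedComposition (quadraticSymbol r c₀ c₁ a b) ↔ a ≠ 4 * b)) := by
  have hr0 : 0 < r := by omega
  have hr' : (2 : ℕ+) ≤ ⟨r, hr0⟩ := hr
  refine ⟨fun hc => ?_, fun hab => ⟨fun h => ?_, fun h => ?_⟩, fun hc => ⟨?_, fun hab => ?_⟩⟩
  · have h := WienerDirichlet.compactComposition_of_lt hr0 c₀ hb hc
    exact ⟨h.imp fun T hT => hT.1, h⟩
  · exact WienerDirichlet.le_re_of_boundedComposition hr' ha hb hab h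
  · exact WienerDirichlet.lt_re_of_compactComposition hr' ha hb hab h
  · rintro h rfl
    refine WienerDirichlet.not_boundedComposition_of_eq hr' hb ?_ h
    rw [hc]
    field_simp
    ring
  · exact WienerDirichlet.boundedComposition_of_ne hr0 c₀ ha hb hab hc.ge
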